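/- Let $\mathbb V$ be a one-dimensional complex vector space with a hermitian norm; choose a linear coordinate $z$ with $\|z\|=|z|$, so that $\mathbb V=\mathbb C$, and identify $\mathbb V^*$ with $\mathbb C$ by $\langle z,w\rangle = zw$. Let $S\subset\mathbb V$ be a non-empty closed convex non-compact subset which contains no line, let $\xi_0\in\mathbb V^*$ (for instance a point on the bisector of the polar cone of the asymptotic cone of $S$) and let $\varepsilon'>0$. For $\varepsilon>0$ put $S_\varepsilon=S+\{|z|\le\varepsilon\}$. **Notation.** For $U\subset\mathbb V$ open, a distributional form on $U$ is *tempered* if it is the restriction to $U$ of a tempered distributional form on $\mathbb V$ (equivalently, if it extends to the projective line $\mathbb P=\mathbb V\cup\{\infty\}$), and $e^{-\langle z,\varepsilon'\xi_0\rangle}\mathcal{D}b^{t,p,q}_{\mathbb P}(U)$ is the space of the distributional $(p,q)$-forms $T$ on $U$ such that $e^{\langle z,\varepsilon'\xi_0\rangle}T$ is tempered. Let $$e^{-\langle z,\varepsilon'\xi_0\rangle}\Omega^{t}_{\mathbb P}(U)=\{\omega \text{ holomorphic }1\text{-form on }U:\ e^{\langle z,\varepsilon'\xi_0\rangle}\omega\text{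 is tempered}\},$$ and let $e^{-\langle z,\varepsilon'\xi_0\rangle}\Omega^{t_\infty}_{\mathbb P}(\mathbb V\setminus S)$ be the space of the holomorphic $1$-forms on $\mathbb V\setminus S$ whose restriction to $\mathbb V\setminus S_\varepsilon$ belongs to $e^{-\langle z,\varepsilon'\xi_0\rangle}\Omega^{t}_{\mathbb P}(\mathbb V\setminus S_\varepsilon)$ for every $\varepsilon>0$. For $Z\subset\mathbb V$ closed, denote by $\Gamma_Z(\mathbb V,\cdot)$ the global sections on $\mathbb V$ supported in $Z$; by the Dolbeault resolution, $$H^1_Z(\mathbb V,e^{-\langle z,\varepsilon'\xi_0\rangle}\Omega^t_{\mathbb P})=\frac{\Gamma_Z(\mathbb V,e^{-\langle z,\varepsilon'\xi_0\rangle}\mathcal{D}b^{t,1,1}_{\mathbb P})}{\bar\partial\,\Gamma_Z(\mathbb V,e^{-\langle z,\varepsilon'\xi_0\rangle}\mathcal{D}b^{t,1,0}_{\mathbb P})}.$$ **Statement.** 1. For every $\varepsilon>0$ there is a $\mathbb C$-linear isomorphism $$\Phi_\varepsilon:\ e^{-\langle z,\varepsilon'\xi_0\rangle}\Omega^{t}_{\mathbb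 P}(\mathbb V\setminus S_\varepsilon)\big/e^{-\langle z,\varepsilon'\xi_0\rangle}\Omega^{t}_{\mathbb P}(\mathbb V)\ \xrightarrow{\ \sim\ }\ H^1_{S_\varepsilon}(\mathbb V,e^{-\langle z,\varepsilon'\xi_0\rangle}\Omega^t_{\mathbb P}),\qquad [\omega]\mapsto[\bar\partial\underline\omega],$$ where $\underline\omega\in e^{-\langle z,\varepsilon'\xi_0\rangle}\mathcal{D}b^{t,1,0}_{\mathbb P}(\mathbb V)$ is an extension of $\omega$ to $\mathbb V$; such an extension exists, and every choice of it gives the same class. 2. There is a $\mathbb C$-linear isomorphism $$\Psi:\ e^{-\langle z,\varepsilon'\xi_0\rangle}\Omega^{t_\infty}_{\mathbb P}(\mathbb V\setminus S)\big/e^{-\langle z,\varepsilon'\xi_0\rangle}\Omega^{t}_{\mathbb P}(\mathbb V)\ \xrightarrow{\ \sim\ }\ \varprojlim_{\varepsilon\to0}H^1_{S_\varepsilon}(\mathbb V,e^{-\langle z,\varepsilon'\xi_0\rangle}\Omega^t_{\mathbb P})$$ (the transition maps being the enlargements of support) whose component of index $\varepsilon$ is $[\omega]\mapsto\Phi_\varepsilon[\omega|_{\mathbb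 V\setminus S_\varepsilon}]$, for every $\varepsilon>0$. 3. For every $\varepsilon>0$, every bounded $C^\infty$ function $\psi_\varepsilon:\mathbb V\to\mathbb R$ equal to $1$ on $\mathbb V\setminus S_\varepsilon$ and to $0$ on $S_{\varepsilon/2}$, and every $\omega\in e^{-\langle z,\varepsilon'\xi_0\rangle}\Omega^{t_\infty}_{\mathbb P}(\mathbb V\setminus S)$, the component of index $\varepsilon$ of $\Psi[\omega]$ is $[\bar\partial(\psi_\varepsilon\omega)]$, where $\psi_\varepsilon\omega$ is extended by $0$ to $\mathbb V$. -/

import Mathlib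

open TopologicalSpace
open scoped Distributions SchwartzMap CompactConvergenceCLM

namespace TempMeril

noncomputable section

/-! ### Distributional forms on open subsets of the complex line

The complex line `V` is `ℂ` with its linear coordinate `z`, and the dual line is `ℂ` with the
pairing `⟨z, w⟩ = z * w`. A distributional form of type `(1,0)` on an open set is written `T dz`,
one of type `(1,1)` is written `T dz̄ ∧ dz`, with `T` a complex distribution; locally integrable
functions are identified with distributions by means of the Lebesgue measure. -/

/-- Complex distributions on the open set `U`. -/
abbrev Distr (U : Opens ℂ) : Type := 𝓓(U, ℂ) →L_c[ℂ] ℂ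

/-- Restriction to the open set `U` of distributions on `ℂ`. -/
def restr (U : Opens ℂ) : Distr ⊤ →ₗ[ℂ] Distr U :=
  ((TestFunction.monoCLM ℂ : 𝓓(U, ℂ) →L[ℂ] 𝓓(⊤, ℂ)).precompCompactConvergenceCLM ℂ).toLinearMap

@[simp]
lemma restr_apply (U : Opens ℂ) (T : Distr ⊤) (φ : 𝓓(U, ℂ)) :
    restr U T φ = T (TestFunction.monoCLM ℂ φ) := rfl

/-- The derivative of a distribution in the direction `v`. -/
def deriv (v : ℂ) (U : Opens ℂ) : Distr U →ₗ[ℂ] Distr U :=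
  -((TestFunction.lineDerivCLM ℂ v : 𝓓(U, ℂ) →L[ℂ] 𝓓(U, ℂ)).precompCompactConvergenceCLM
    ℂ).toLinearMap

@[simp]
lemma deriv_apply (v : ℂ) (U : Opens ℂ) (T : Distr U) (φ : 𝓓(U, ℂ)) :
    deriv v U T φ = -T (TestFunction.lineDerivCLM ℂ v φ) := rfl

/-- The Dolbeault operator on distributional forms, `∂̄ (T dz) = (∂T/∂z̄) dz̄ ∧ dz`, where
`∂/∂z̄ = (∂/∂x + i ∂/∂y) / 2`. -/
def dbar (U : Opens ℂ) : Distr U →ₗ[ℂ] Distr U :=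
  (1 / 2 : ℂ) • (deriv 1 U + Complex.I • deriv Complex.I U)

lemma dbar_apply (U : Opens ℂ) (T : Distr U) (φ : 𝓓(U, ℂ)) :
    dbar U T φ = 1 / 2 * (-T (TestFunction.lineDerivCLM ℂ 1 φ)
      + Complex.I * -T (TestFunction.lineDerivCLM ℂ Complex.I φ)) := by
  simp [dbar, -TestFunction.lineDerivCLM_apply]
  ring

/-- The exponential `z ↦ exp ⟨z, c⟩`. -/
def expPair (c : ℂ) : ℂ → ℂ := fun z ↦ Complex.exp (z * c)

lemma contDiff_expPair (c : ℂ) {n : WithTop ℕ∞} : ContDiff ℝ n (expPair c) := by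
  unfold expPair
  exact (contDiff_id.mul contDiff_const).cexp

/-- Multiplication of test functions by `exp ⟨z, c⟩`. -/
def expTest (c : ℂ) (U : Opens ℂ) : 𝓓(U, ℂ) →L[ℂ] 𝓓(U, ℂ) :=
  TestFunction.limitCLM ℂ
    (fun φ ↦ ⟨fun z ↦ expPair c z * φ z, (contDiff_expPair c).mul φ.contDiff,
      φ.hasCompactSupport.mul_left, (tsupport_mul_subset_right).trans φ.tsupport_subset⟩)
    (fun _ hK ↦ (TestFunction.ofSupportedInCLM ℂ hK).comp
      (ContDiffMapSupportedIn.bilinLeftCLM (ContinuousLinearMap.mul ℂ ℂ).flip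
        (contDiff_expPair c)))
    (fun _ _ _ ↦ by ext; simp [mul_comm])

@[simp]
lemma expTest_apply (c : ℂ) (U : Opens ℂ) (φ : 𝓓(U, ℂ)) (z : ℂ) :
    expTest c U φ z = expPair c z * φ z := rfl

/-- Multiplication of distributions by `exp ⟨z, c⟩`. -/
def expDist (c : ℂ) (U : Opens ℂ) : Distr U →ₗ[ℂ] Distr U :=
  ((expTest c U).precompCompactConvergenceCLM ℂ).toLinearMap

@[simp]
lemma expDist_apply (c : ℂ) (U : Opens ℂ) (T : Distr U) (φ : 𝓓(U, ℂ)) :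
    expDist c U T φ = T (expTest c U φ) := rfl

/-- A test function, seen as a Schwartz function on `ℂ`. -/
def toSchwartz {U : Opens ℂ} (φ : 𝓓(U, ℂ)) : 𝓢(ℂ, ℂ) :=
  φ.hasCompactSupport.toSchwartzMap φ.contDiff

@[simp]
lemma toSchwartz_apply {U : Opens ℂ} (φ : 𝓓(U, ℂ)) (z : ℂ) : toSchwartz φ z = φ z := rfl

/-- Tempered distributions on the open set `U`: those which are the restriction to `U` of a
tempered distribution on `ℂ`, that is to say of a distribution on `ℂ` that can be extended to the
projective line. -/
def tempered (U : Opens ℂ) : Submodule ℂ (Distr U) where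
  carrier := {T | ∃ τ : 𝓢'(ℂ, ℂ), ∀ φ : 𝓓(U, ℂ), T φ = τ (toSchwartz φ)}
  add_mem' := by
    rintro S T ⟨σ, hσ⟩ ⟨τ, hτ⟩
    exact ⟨σ + τ, fun φ ↦ by simp [hσ, hτ]⟩
  zero_mem' := ⟨0, fun φ ↦ by simp⟩
  smul_mem' := by
    rintro a T ⟨τ, hτ⟩
    exact ⟨a • τ, fun φ ↦ by simp [hτ]⟩

/-- The distributions `T` on `U` such that `exp ⟨z, c⟩ T` is tempered. They are the coefficients
of the sections over `U` of the weighted sheaves of distributional forms of type `(1,0)` and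
`(1,1)`, with weight `exp (-⟨z, c⟩)`. -/
def wTempered (c : ℂ) (U : Opens ℂ) : Submodule ℂ (Distr U) :=
  (tempered U).comap (expDist c U)

/-! ### Cohomology with support in a closed set -/

/-- Global sections, supported in the closed set `Z`, of the weighted sheaf of tempered
distributional forms of type `(1,0)`, or of type `(1,1)`. -/
def secSupp (c : ℂ) (Z : Closeds ℂ) : Submodule ℂ (Distr ⊤) :=
  wTempered c ⊤ ⊓ LinearMap.ker (restr Z.compl)

lemma lineDeriv_testFunction {U : Opens ℂ} (φ : 𝓓(U, ℂ)) (v z : ℂ) :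
    (TestFunction.lineDerivCLM ℂ v φ : 𝓓(U, ℂ)) z = fderiv ℝ φ z v := by
  have h : DifferentiableAt ℝ φ z := (φ.contDiff.differentiable (by simp)).differentiableAt
  simp [h.lineDeriv_eq_fderiv]

lemma lineDeriv_expTest (c : ℂ) {U : Opens ℂ} (φ : 𝓓(U, ℂ)) (v : ℂ) :
    (TestFunction.lineDerivCLM ℂ v (expTest c U φ) : 𝓓(U, ℂ)) =
      expTest c U (TestFunction.lineDerivCLM ℂ v φ) + (v * c) • expTest c U φ := by
  ext z
  have h1 : DifferentiableAt ℝ φ z := (φ.contDiff.differentiable (by simp)).differentiableAt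
  have h2 : HasDerivAt (expPair c) (expPair c z * c) z := by
    have := (hasDerivAt_mul_const (x := z) c).cexp
    exact this
  have h3 : HasFDerivAt (fun y ↦ expPair c y * φ y) _ z :=
    (h2.hasFDerivAt.restrictScalars ℝ).mul h1.hasFDerivAt
  have h4 : (expTest c U φ : ℂ → ℂ) = fun y ↦ expPair c y * φ y := rfl
  rw [lineDeriv_testFunction, h4, h3.fderiv]
  simp [lineDeriv_testFunction, -TestFunction.lineDerivCLM_apply]
  ring

lemma dbar_mem_wTempered {c : ℂ} {U : Opens ℂ} {T : Distr U} (hT : T ∈ wTempered c U) :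
    dbar U T ∈ wTempered c U := by
  obtain ⟨τ, hτ⟩ := hT
  have key (φ : 𝓓(U, ℂ)) (v : ℂ) : T (expTest c U (TestFunction.lineDerivCLM ℂ v φ)) =
      τ (LineDeriv.lineDerivOp v (toSchwartz φ)) := by
    have := hτ (TestFunction.lineDerivCLM ℂ v φ)
    rw [expDist_apply] at this
    rw [this]
    congr 1
  refine ⟨(1 / 2 : ℂ) • (LineDeriv.lineDerivOp (1 : ℂ) τ
    + Complex.I • LineDeriv.lineDerivOp Complex.I τ), fun φ ↦ ?_⟩
  rw [expDist_apply, dbar_apply, lineDeriv_expTest, lineDeriv_expTest, map_add, map_add, map_smul,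
    map_smul, key, key]
  simp
  linear_combination (-1 / 2 * c * T (expTest c U φ)) * Complex.I_mul_I

lemma dbar_mem_secSupp {c : ℂ} {Z : Closeds ℂ} {T : Distr ⊤} (hT : T ∈ secSupp c Z) :
    dbar ⊤ T ∈ secSupp c Z := by
  refine ⟨dbar_mem_wTempered hT.1, ?_⟩
  have h0 (φ : 𝓓(Z.compl, ℂ)) : T (TestFunction.monoCLM ℂ φ) = 0 :=
    DFunLike.congr_fun (LinearMap.mem_ker.1 hT.2) φ
  have h1 (φ : 𝓓(Z.compl, ℂ)) (v : ℂ) :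
      (TestFunction.lineDerivCLM ℂ v (TestFunction.monoCLM ℂ φ : 𝓓(⊤, ℂ)) : 𝓓(⊤, ℂ)) =
        TestFunction.monoCLM ℂ (TestFunction.lineDerivCLM ℂ v φ : 𝓓(Z.compl, ℂ)) := by
    ext z
    rw [lineDeriv_testFunction]
    simp [lineDeriv_testFunction, -TestFunction.lineDerivCLM_apply]
  refine LinearMap.mem_ker.2 ?_
  ext φ
  rw [restr_apply, dbar_apply, h1, h1, h0, h0]
  simp

/-- The Dolbeault operator, from sections of type `(1,0)` supported in `Z` to sections of type
`(1,1)` supported in `Z`. -/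
def dbarSupp (c : ℂ) (Z : Closeds ℂ) : secSupp c Z →ₗ[ℂ] secSupp c Z :=
  (dbar ⊤).restrict fun _ hT ↦ dbar_mem_secSupp hT

/-- The cohomology space `H¹_Z(V, e^{-⟨z, c⟩} Ω^t)`, in degree one of the complex of global
sections supported in `Z` of the weighted tempered Dolbeault complex
`0 → e^{-⟨z, c⟩} Db^{t,1,0} → e^{-⟨z, c⟩} Db^{t,1,1} → 0`. -/
abbrev H1 (c : ℂ) (Z : Closeds ℂ) : Type :=
  secSupp c Z ⧸ LinearMap.range (dbarSupp c Z)

lemma secSupp_mono (c : ℂ) {Z Z' : Closeds ℂ} (h : Z ≤ Z') : secSupp c Z ≤ secSupp c Z' := by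
  refine fun T hT ↦ ⟨hT.1, ?_⟩
  refine LinearMap.mem_ker.2 ?_
  ext φ
  have h1 : Z'.compl ≤ Z.compl := Set.compl_subset_compl.2 h
  have h0 : T (TestFunction.monoCLM ℂ (TestFunction.monoCLM ℂ φ : 𝓓(Z.compl, ℂ))) = 0 :=
    DFunLike.congr_fun (LinearMap.mem_ker.1 hT.2) (TestFunction.monoCLM ℂ φ : 𝓓(Z.compl, ℂ))
  have h2 : (TestFunction.monoCLM ℂ (TestFunction.monoCLM ℂ φ : 𝓓(Z.compl, ℂ)) : 𝓓(⊤, ℂ)) =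
      TestFunction.monoCLM ℂ φ := by
    ext z
    simp [h1]
  rw [h2] at h0
  exact h0

/-- Enlarging the support, `H¹_Z → H¹_{Z'}` for `Z ⊆ Z'`. -/
def H1map (c : ℂ) {Z Z' : Closeds ℂ} (h : Z ≤ Z') : H1 c Z →ₗ[ℂ] H1 c Z' :=
  Submodule.mapQ _ _ (Submodule.inclusion (secSupp_mono c h)) <| by
    rintro _ ⟨T, rfl⟩
    exact ⟨Submodule.inclusion (secSupp_mono c h) T, rfl⟩

/-! ### Holomorphic forms -/

/-- The holomorphic functions on the open set `U`, extended by zero outside of `U`. -/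
def holoFun (U : Opens ℂ) : Submodule ℂ (ℂ → ℂ) where
  carrier := {u | DifferentiableOn ℂ u U ∧ ∀ z ∉ U, u z = 0}
  add_mem' := by
    rintro u v ⟨hu, hu'⟩ ⟨hv, hv'⟩
    exact ⟨hu.add hv, fun z hz ↦ by simp [hu' z hz, hv' z hz]⟩
  zero_mem' := ⟨differentiableOn_const 0, fun _ _ ↦ rfl⟩
  smul_mem' := by
    rintro a u ⟨hu, hu'⟩
    exact ⟨hu.const_smul a, fun z hz ↦ by simp [hu' z hz]⟩

/-- The holomorphic forms `u dz` on the open set `U`, identified with their coefficient `u`. -/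
def Holo (U : Opens ℂ) : Type := holoFun U

instance (U : Opens ℂ) : AddCommGroup (Holo U) := inferInstanceAs (AddCommGroup (holoFun U))

instance (U : Opens ℂ) : Module ℂ (Holo U) := inferInstanceAs (Module ℂ (holoFun U))

/-- The coefficient of a holomorphic form. -/
def coeff {U : Opens ℂ} : Holo U →ₗ[ℂ] ℂ → ℂ := (holoFun U).subtype

lemma differentiableOn_coeff {U : Opens ℂ} (u : Holo U) : DifferentiableOn ℂ (coeff u) U := u.2.1

lemma coeff_eq_zero {U : Opens ℂ} (u : Holo U) {z : ℂ} (hz : z ∉ U) : coeff u z = 0 := u.2.2 z hz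

lemma coeff_injective {U : Opens ℂ} : Function.Injective (coeff (U := U)) :=
  Subtype.val_injective

/-- Restriction of holomorphic forms. -/
def holoRestr {U W : Opens ℂ} (h : W ≤ U) : Holo U →ₗ[ℂ] Holo W where
  toFun u := ⟨(W : Set ℂ).indicator (coeff u),
    ((differentiableOn_coeff u).mono h).congr fun _ hz ↦ Set.indicator_of_mem hz _,
    fun _ hz ↦ Set.indicator_of_notMem hz _⟩
  map_add' u v := coeff_injective (Set.indicator_add (W : Set ℂ) (coeff u) (coeff v))
  map_smul' a u := coeff_injective (Set.indicator_const_smul (W : Set ℂ) a (coeff u))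

lemma coeff_holoRestr {U W : Opens ℂ} (h : W ≤ U) (u : Holo U) :
    coeff (holoRestr h u) = (W : Set ℂ).indicator (coeff u) := rfl

lemma holoRestr_holoRestr {U W X : Opens ℂ} (h : W ≤ U) (h' : X ≤ W) (u : Holo U) :
    holoRestr h' (holoRestr h u) = holoRestr (h'.trans h) u := by
  apply coeff_injective
  rw [coeff_holoRestr, coeff_holoRestr, coeff_holoRestr, Set.indicator_indicator,
    Set.inter_eq_left.2 h']

/-- The distribution on `U` defined by a locally integrable function on `U`. -/
def ofFun (U : Opens ℂ) (u : ℂ → ℂ) : Distr U :=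
  ContinuousLinearMap.toUniformConvergenceCLM _ _ _ <|
    TestFunction.integralAgainstBilinCLM (ContinuousLinearMap.mul ℂ ℂ) MeasureTheory.volume u

lemma locallyIntegrableOn_coeff {U : Opens ℂ} (u : Holo U) :
    MeasureTheory.LocallyIntegrableOn (coeff u) U :=
  (differentiableOn_coeff u).continuousOn.locallyIntegrableOn U.isOpen.measurableSet

lemma ofFun_coeff_apply {U : Opens ℂ} (u : Holo U) (φ : 𝓓(U, ℂ)) :
    ofFun U (coeff u) φ = ∫ z, φ z * coeff u z :=
  TestFunction.integralAgainstBilinCLM_eq_integral (locallyIntegrableOn_coeff u)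

/-- Holomorphic forms seen as distributional forms of type `(1,0)`. -/
def holoDistr (U : Opens ℂ) : Holo U →ₗ[ℂ] Distr U where
  toFun u := ofFun U (coeff u)
  map_add' u v := by
    ext φ
    have h (w : Holo U) : MeasureTheory.Integrable fun z ↦ φ z * coeff w z :=
      φ.integrable_bilin (ContinuousLinearMap.mul ℂ ℂ) (locallyIntegrableOn_coeff w)
    rw [add_apply, ofFun_coeff_apply, ofFun_coeff_apply, ofFun_coeff_apply,
      ← MeasureTheory.integral_add (h u) (h v)]
    simp [mul_add]
  map_smul' a u := by
    ext φ
    rw [smul_apply, ofFun_coeff_apply, ofFun_coeff_apply, smul_eq_mul,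
      RingHom.id_apply, ← MeasureTheory.integral_const_mul]
    congr 1 with z
    simp
    ring

lemma holoDistr_apply {U : Opens ℂ} (u : Holo U) (φ : 𝓓(U, ℂ)) :
    holoDistr U u φ = ∫ z, φ z * coeff u z := ofFun_coeff_apply u φ

/-- The space `e^{-⟨z, c⟩} Ω^t(U)` of the holomorphic forms `ω` on `U` such that `e^{⟨z, c⟩} ω` is
tempered. -/
def wOmega (c : ℂ) (U : Opens ℂ) : Submodule ℂ (Holo U) :=
  (wTempered c U).comap (holoDistr U)

lemma holoRestr_mem_wOmega {c : ℂ} {U W : Opens ℂ} (h : W ≤ U) {u : Holo U}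
    (hu : u ∈ wOmega c U) : holoRestr h u ∈ wOmega c W := by
  obtain ⟨τ, hτ⟩ := hu
  refine ⟨τ, fun φ ↦ ?_⟩
  have h1 := hτ (TestFunction.monoCLM ℂ φ)
  have h2 : toSchwartz (TestFunction.monoCLM ℂ φ : 𝓓(U, ℂ)) = toSchwartz φ := by
    ext z
    simp [h]
  rw [h2] at h1
  rw [← h1]
  rw [expDist_apply, expDist_apply, holoDistr_apply, holoDistr_apply]
  congr 1 with z
  by_cases hz : z ∈ W
  · simp [coeff_holoRestr, h, hz]
  · have h3 : φ z = 0 := image_eq_zero_of_notMem_tsupport fun h' ↦ hz (φ.tsupport_subset h')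
    simp [h, h3]

/-- Restriction of weighted tempered holomorphic forms. -/
def wOmegaRestr (c : ℂ) {U W : Opens ℂ} (h : W ≤ U) : wOmega c U →ₗ[ℂ] wOmega c W :=
  (holoRestr h).restrict fun _ hu ↦ holoRestr_mem_wOmega h hu

/-- The quotient `e^{-⟨z, c⟩} Ω^t(V \ Z) / e^{-⟨z, c⟩} Ω^t(V)`. -/
abbrev OmegaQuot (c : ℂ) (Z : Closeds ℂ) : Type :=
  wOmega c Z.compl ⧸ LinearMap.range (wOmegaRestr c (le_top : Z.compl ≤ ⊤))

/-! ### The limit of small thickenings -/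

/-- The closed thickening `S_ε = S + {|z| ≤ ε}`. -/
def thick (S : Closeds ℂ) (ε : ℝ) : Closeds ℂ :=
  ⟨Metric.cthickening ε (S : Set ℂ), Metric.isClosed_cthickening⟩

open scoped Pointwise in
lemma coe_thick (S : Closeds ℂ) {ε : ℝ} (hε : 0 ≤ ε) :
    (thick S ε : Set ℂ) = (S : Set ℂ) + Metric.closedBall 0 ε := by
  ext z
  rw [thick, Closeds.coe_mk, Metric.cthickening_eq_biUnion_closedBall _ hε, S.isClosed.closure_eq]
  simp only [Set.mem_iUnion, Set.mem_add, exists_prop]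
  constructor
  · rintro ⟨x, hx, hz⟩
    exact ⟨x, hx, z - x, by simpa [dist_eq_norm] using hz, by ring⟩
  · rintro ⟨x, hx, y, hy, rfl⟩
    exact ⟨x, hx, by simpa [dist_eq_norm] using hy⟩

lemma thick_mono (S : Closeds ℂ) {ε₁ ε₂ : ℝ} (h : ε₁ ≤ ε₂) : thick S ε₁ ≤ thick S ε₂ :=
  Metric.cthickening_mono h _

lemma compl_thick_le (S : Closeds ℂ) (ε : ℝ) : (thick S ε).compl ≤ S.compl :=
  Set.compl_subset_compl.2 (Metric.self_subset_cthickening _)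

/-- The space `e^{-⟨z, c⟩} Ω^{t∞}(V \ S)` of the holomorphic forms `ω` on `V \ S` such that
`e^{⟨z, c⟩} ω` is tempered at infinity, the boundary of `S` being left out: it is tempered on
`V \ S_ε` for all `ε > 0`. -/
def wOmegaInf (c : ℂ) (S : Closeds ℂ) : Submodule ℂ (Holo S.compl) :=
  ⨅ ε : Set.Ioi (0 : ℝ), (wOmega c (thick S ε).compl).comap (holoRestr (compl_thick_le S ε))

/-- The restriction `e^{-⟨z, c⟩} Ω^{t∞}(V \ S) → e^{-⟨z, c⟩} Ω^t(V \ S_ε)`. -/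
def infToThick (c : ℂ) (S : Closeds ℂ) (ε : Set.Ioi (0 : ℝ)) :
    wOmegaInf c S →ₗ[ℂ] wOmega c (thick S ε).compl :=
  (holoRestr (compl_thick_le S ε)).restrict fun _ hu ↦ (Submodule.mem_iInf _).1 hu ε

/-- The restriction `e^{-⟨z, c⟩} Ω^t(V) → e^{-⟨z, c⟩} Ω^{t∞}(V \ S)`. -/
def wOmegaToInf (c : ℂ) (S : Closeds ℂ) : wOmega c ⊤ →ₗ[ℂ] wOmegaInf c S :=
  (holoRestr le_top).restrict fun u hu ↦ (Submodule.mem_iInf _).2 fun ε ↦ by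
    rw [Submodule.mem_comap, holoRestr_holoRestr]
    exact holoRestr_mem_wOmega _ hu

/-- The quotient `e^{-⟨z, c⟩} Ω^{t∞}(V \ S) / e^{-⟨z, c⟩} Ω^t(V)`. -/
abbrev OmegaInfQuot (c : ℂ) (S : Closeds ℂ) : Type :=
  wOmegaInf c S ⧸ LinearMap.range (wOmegaToInf c S)

/-- The projective limit of the spaces `H¹_{S_ε}(V, e^{-⟨z, c⟩} Ω^t)` for `ε → 0`. -/
def limH1 (c : ℂ) (S : Closeds ℂ) :
    Submodule ℂ (∀ ε : Set.Ioi (0 : ℝ), H1 c (thick S ε)) where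
  carrier := {x | ∀ (ε₁ ε₂ : Set.Ioi (0 : ℝ)) (h : ε₁ ≤ ε₂),
    H1map c (thick_mono S h) (x ε₁) = x ε₂}
  add_mem' hx hy ε₁ ε₂ h := by simp [hx ε₁ ε₂ h, hy ε₁ ε₂ h]
  zero_mem' ε₁ ε₂ h := by simp
  smul_mem' a x hx ε₁ ε₂ h := by simp [hx ε₁ ε₂ h]

end

end TempMeril

namespace TempMeril

noncomputable section

open MeasureTheory Set Filter Topology Complex

/-! ### The Cauchy–Pompeiu formula at the origin. -/

section CauchyPompeiu

variable {F : Type*} [NormedAddCommGroup F] [NormedSpace ℂ F]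

/-! Fix `Z = S_ε`. Temperedness of a form `ω` off `Z` provides a weighted tempered extension `T` to
the whole line. Then `∂̄T` is supported in `Z`, and another extension differs from `T` by a section
supported in `Z`, so the class `[∂̄T]` is well defined. That `[ω] ↦ [∂̄T]` is an isomorphism follows
from two properties of `∂̄` on weighted tempered distributions: it is surjective on the line
(`exists_dbar_eq`), and its solutions are holomorphic (`exists_restr_eq_holoDistr`). For
surjectivity, solve `∂̄T = R`: since `R` vanishes off `Z`, `T` is holomorphic there. For
injectivity, if `∂̄T = ∂̄Q` with `Q` supported in `Z`, then `T - Q` is entire and equals `ω` off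
`Z`. The weight is entire and nowhere zero, so it commutes with `∂̄`, and both properties reduce to
the unweighted case (`expDist_dbar_apply`).

Both properties come from the Cauchy–Pompeiu formula `integral_inv_smul_dbarFun`. It bounds every
Schwartz seminorm of `φ` by a continuous function of `∂̄φ`, so `∂̄` has a continuous inverse on its
range, and Hahn–Banach then solves the transposed equation (`exists_comp_dbarSchwartz_eq`). With a
cutoff, it gives a smooth mean value kernel `k` and a parametrix `P` with `φ = k * φ + P * ∂̄φ`
(`exists_kernel`). From these follow Weyl's lemma and polynomial bounds for tempered holomorphic
functions away from the boundary.

In the limit, the forms subtracted in the quotient are entire and do not depend on `ε`. The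
complement of each `S_ε` is nonempty, because `S` lies in a half-plane (`nonempty_compl_thick`), so
the identity theorem makes entire forms agree as soon as they agree off some `S_ε`. Hence
representatives of a compatible family can be normalised against the one at `ε = 1` and glued.

For the cutoff formula, a bounded smooth `ψ` with uncontrolled derivatives need not preserve
temperedness of distributions. The pointwise polynomial bound of `e^{⟨z,c⟩}ω` off `S_{ε/2}` makes
`ψω` weighted tempered, so it is one of the admissible extensions. -/

/-- The Cauchy–Riemann operator `∂/∂z̄` on differentiable functions. -/
def dbarFun (h : ℂ → F) (z : ℂ) : F :=
  (1 / 2 : ℂ) • (fderiv ℝ h z 1 + I • fderiv ℝ h z I)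

variable (F) in
/-- The Cauchy–Riemann operator on Schwartz functions. -/
def dbarSchwartz : 𝓢(ℂ, F) →L[ℂ] 𝓢(ℂ, F) :=
  (1 / 2 : ℂ) • (LineDeriv.lineDerivOpCLM ℂ 𝓢(ℂ, F) (1 : ℂ)
    + I • LineDeriv.lineDerivOpCLM ℂ 𝓢(ℂ, F) I)

lemma dbarSchwartz_apply (h : 𝓢(ℂ, F)) (z : ℂ) : dbarSchwartz F h z = dbarFun h z := by
  simp [dbarSchwartz, dbarFun, SchwartzMap.lineDerivOp_apply_eq_fderiv]

/-- Only the conjugate-linear part of `l` survives in `l e + I • l (I * e)`, and it scales by the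
conjugate of `e`. With `e = exp (iθ)` this expresses `∂̄` through radial and angular derivatives. -/
lemma map_add_I_smul_map (l : ℂ →L[ℝ] F) {e : ℂ} (he : ‖e‖ = 1) :
    l e + I • l (I * e) = e⁻¹ • (l 1 + I • l I) := by
  have h1 (w : ℂ) : l w = (w.re : ℂ) • l 1 + (w.im : ℂ) • l I := by
    have : w = w.re • (1 : ℂ) + w.im • I := by simp
    conv_lhs => rw [this, map_add, map_smul, map_smul]
    simp
  rw [h1 e, h1 (I * e), inv_eq_conj he]
  have h2 : (starRingEnd ℂ) e = e.re - e.im * I := by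
    apply Complex.ext <;> simp
  rw [h2]
  simp only [smul_add, smul_smul, I_mul_re, I_mul_im, ofReal_neg]
  match_scalars <;> ring_nf
  simp

lemma exists_norm_fderiv_le (h : 𝓢(ℂ, F)) :
    ∃ C, ∀ z, ‖fderiv ℝ h z‖ ≤ C * (1 + ‖z‖ ^ 2)⁻¹ := by
  refine ⟨SchwartzMap.seminorm ℝ 0 1 h + SchwartzMap.seminorm ℝ 2 1 h, fun z ↦ ?_⟩
  have h1 := SchwartzMap.le_seminorm ℝ 0 1 h z
  have h2 := SchwartzMap.le_seminorm ℝ 2 1 h z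
  rw [norm_iteratedFDeriv_one] at h1 h2
  rw [← div_eq_mul_inv, le_div_iff₀ (by positivity)]
  linarith

/-- In polar coordinates the Jacobian `r` cancels the modulus of `z⁻¹`, and the integrand becomes
half of the radial derivative plus `i` times the angular one divided by `r`. The radial part
integrates to the value at the origin, the angular part to zero by periodicity. -/
lemma integral_inv_smul_dbarFun [CompleteSpace F] (h : 𝓢(ℂ, F)) :
    ∫ z, z⁻¹ • dbarFun h z = -(Real.pi : ℂ) • h 0 := by
  set e : ℝ → ℂ := fun θ ↦ Complex.exp (θ * I) with he
  have he1 (θ : ℝ) : ‖e θ‖ = 1 := norm_exp_ofReal_mul_I θ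
  have hecont : Continuous e := by fun_prop
  have hed (θ : ℝ) : HasDerivAt e (I * e θ) θ := by
    have := ((hasDerivAt_id (θ : ℂ)).mul_const I).cexp.comp_ofReal
    simpa [he, mul_comm] using this
  set A : ℝ × ℝ → F := fun p ↦ fderiv ℝ h (p.1 * e p.2) (e p.2) with hA
  set B : ℝ × ℝ → F := fun p ↦ fderiv ℝ h (p.1 * e p.2) (I * e p.2) with hB
  have hfd : Continuous (fderiv ℝ h) := (h.smooth 1).continuous_fderiv (by simp)
  have hAc : Continuous A := by
    apply Continuous.clm_apply <;> fun_prop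
  have hBc : Continuous B := by
    apply Continuous.clm_apply <;> fun_prop
  obtain ⟨C, hC⟩ := exists_norm_fderiv_le h
  have hbd (p : ℝ × ℝ) (w : ℂ) (hw : ‖w‖ = 1) :
      ‖fderiv ℝ h (p.1 * e p.2) w‖ ≤ C * (1 + p.1 ^ 2)⁻¹ := by
    refine (ContinuousLinearMap.le_opNorm _ _).trans ?_
    rw [hw, mul_one]
    refine (hC _).trans_eq ?_
    simp [he1]
  set μ : Measure ℝ := volume.restrict (Ioi 0)
  set ν : Measure ℝ := volume.restrict (Ioo (-Real.pi) Real.pi)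
  -- No Jacobian is left, so decay of order two in `r` suffices.
  have hdom : Integrable (fun p : ℝ × ℝ ↦ C * (1 + p.1 ^ 2)⁻¹) (μ.prod ν) :=
    Integrable.comp_fst (f := fun r : ℝ ↦ C * (1 + r ^ 2)⁻¹)
      ((integrable_inv_one_add_sq.const_mul C).integrableOn) ν
  have hAi : Integrable A (μ.prod ν) :=
    hdom.mono' hAc.aestronglyMeasurable (.of_forall fun p ↦ hbd p _ (he1 _))
  have hBi : Integrable B (μ.prod ν) :=
    hdom.mono' hBc.aestronglyMeasurable (.of_forall fun p ↦ hbd p _ (by simp [he1]))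
  have hAint : ∫ p, A p ∂(μ.prod ν) = -(2 * Real.pi) • h 0 := by
    rw [integral_prod_symm _ hAi]
    have h1 (θ : ℝ) : ∫ r, A (r, θ) ∂μ = - h 0 := by
      have h2 (r : ℝ) : HasDerivAt (fun r : ℝ ↦ h (r * e θ)) (A (r, θ)) r := by
        have h3 : HasDerivAt (fun r : ℝ ↦ (r : ℂ) * e θ) (e θ) r := by
          simpa using (hasDerivAt_id (r : ℂ)).comp_ofReal.mul_const (e θ)
        exact (h.hasFDerivAt _).comp_hasDerivAt r h3
      have h4 : Tendsto (fun r : ℝ ↦ h (r * e θ)) atTop (𝓝 0) := by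
        refine h.tendsto_cocompact.comp ?_
        rw [← Metric.cobounded_eq_cocompact, ← tendsto_norm_atTop_iff_cobounded]
        simpa [he1] using tendsto_abs_atTop_atTop
      have h5 : IntegrableOn (fun r ↦ A (r, θ)) (Ioi 0) := by
        refine Integrable.mono' ((integrable_inv_one_add_sq.const_mul C).integrableOn)
          (by fun_prop) (.of_forall fun r ↦ hbd (r, θ) _ (he1 _))
      have := integral_Ioi_of_hasDerivAt_of_tendsto' (fun r _ ↦ h2 r) h5 h4
      simpa using this
    simp_rw [h1]
    rw [integral_const]
    simp [ν, Real.pi_pos.le, Measure.real]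
    rw [← two_mul]
  have hBint : ∫ p, B p ∂(μ.prod ν) = 0 := by
    rw [integral_prod _ hBi]
    refine integral_eq_zero_of_ae ?_
    filter_upwards [ae_restrict_mem measurableSet_Ioi] with r hr
    -- The `θ`-derivative is `r • B`. Its integral over a period vanishes, and `r > 0` can then be
    -- divided out.
    have h2 (θ : ℝ) : HasDerivAt (fun θ : ℝ ↦ h (r * e θ)) (r • B (r, θ)) θ := by
      have h3 : HasDerivAt (fun θ : ℝ ↦ (r : ℂ) * e θ) (r • (I * e θ)) θ := by
        rw [real_smul]
        exact (hed θ).const_mul _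
      have := (h.hasFDerivAt _).comp_hasDerivAt θ h3
      rwa [map_smul] at this
    have h3 := intervalIntegral.integral_eq_sub_of_hasDerivAt (a := -Real.pi) (b := Real.pi)
      (fun θ _ ↦ h2 θ) (Continuous.intervalIntegrable (by fun_prop) _ _)
    rw [intervalIntegral.integral_smul, intervalIntegral.integral_of_le (by linarith [Real.pi_pos]),
      integral_Ioc_eq_integral_Ioo] at h3
    have h4 : e Real.pi = e (-Real.pi) := by
      simp [he, Complex.exp_neg, exp_pi_mul_I]
    rw [h4, sub_self, smul_eq_zero] at h3
    exact h3.resolve_left (ne_of_gt hr)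
  rw [← Complex.integral_comp_polarCoord_symm, polarCoord_target, Measure.volume_eq_prod,
    ← Measure.prod_restrict]
  have : ∫ p, (1 / 2 : ℂ) • (A p + I • B p) ∂(μ.prod ν) = -(Real.pi : ℂ) • h 0 := by
    rw [integral_smul, integral_add hAi (show Integrable (fun p ↦ I • B p) _ from hBi.smul I), integral_smul, hAint, hBint]
    rw [← Complex.coe_smul]
    simp [smul_smul]
  rw [← this]
  refine integral_congr_ae ?_
  have hmem : ∀ᵐ p ∂(μ.prod ν), 0 < p.1 := by
    have : μ.prod ν = volume.restrict (Ioi 0 ×ˢ Ioo (-Real.pi) Real.pi) := by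
      rw [Measure.volume_eq_prod, Measure.prod_restrict]
    rw [this]
    filter_upwards [ae_restrict_mem (measurableSet_Ioi.prod measurableSet_Ioo)] with p hp
    exact hp.1
  filter_upwards [hmem] with p hp
  have h1 : Complex.polarCoord.symm p = p.1 * e p.2 := by
    simp [he, Complex.exp_mul_I]
  rw [h1, hA, hB]
  simp only
  rw [map_add_I_smul_map _ (he1 _), dbarFun, ← Complex.coe_smul]
  have h2 : (p.1 : ℂ) ≠ 0 := by exact_mod_cast hp.ne'
  simp only [smul_smul, mul_inv]
  congr 1
  field_simp

end CauchyPompeiu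

end

end TempMeril

namespace TempMeril

noncomputable section

open MeasureTheory Set Filter Topology Complex

/-! ### A priori estimates for `∂̄` and its surjectivity on tempered distributions. -/

section Division

lemma integrableOn_ball_norm_inv (r : ℝ) :
    IntegrableOn (fun z : ℂ ↦ ‖z‖⁻¹) (Metric.ball 0 r) := by
  have h := integrableOn_fun_norm_addHaar (E := ℂ) volume (f := fun y : ℝ ↦ y⁻¹) (r := r)
  refine h.2 ?_
  have : IntegrableOn (fun _ : ℝ ↦ (1 : ℝ)) (Ioo 0 r) := by simp
  refine this.congr_fun (fun y hy ↦ ?_) measurableSet_Ioo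
  have : y ≠ 0 := hy.1.ne'
  simp [this]

lemma dbarFun_comp_add_right (g : ℂ → ℂ) (x z : ℂ) :
    dbarFun (fun w ↦ g (w + x)) z = dbarFun g (z + x) := by
  simp [dbarFun, fderiv_comp_add_right]

/-- The supremum of a Schwartz function is controlled by its image by the Cauchy–Riemann
operator. -/
lemma exists_norm_le_dbarSchwartz :
    ∃ C : ℝ, 0 ≤ C ∧ ∀ (g : 𝓢(ℂ, ℂ)) (x : ℂ), ‖g x‖ ≤
      C * SchwartzMap.seminorm ℝ 0 0 (dbarSchwartz ℂ g) + ‖(dbarSchwartz ℂ g).toLp 1‖ := by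
  -- In Cauchy–Pompeiu at `x`, the kernel is split at the unit circle: inside it is integrable and
  -- `∂̄g` is bounded by its supremum, outside it is at most one and the `L¹` norm takes over.
  refine ⟨∫ z in Metric.ball (0 : ℂ) 1, ‖z‖⁻¹, by positivity, fun g x ↦ ?_⟩
  set D := dbarSchwartz ℂ g with hD
  set M := SchwartzMap.seminorm ℝ 0 0 D
  have h1 := integral_inv_smul_dbarFun (SchwartzMap.compSubConstCLM ℂ (-x) g)
  have h2 : (SchwartzMap.compSubConstCLM ℂ (-x) g : ℂ → ℂ) = fun w ↦ g (w + x) := by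
    ext w; simp
  rw [h2] at h1
  simp only [dbarFun_comp_add_right, ← dbarSchwartz_apply, ← hD, zero_add] at h1
  have hi1 : Integrable (fun z : ℂ ↦ (Metric.ball (0 : ℂ) 1).indicator (fun z ↦ ‖z‖⁻¹) z * M) :=
    ((integrableOn_ball_norm_inv 1).integrable_indicator measurableSet_ball).mul_const M
  have hi2 : Integrable (fun z : ℂ ↦ ‖D (z + x)‖) := (D.integrable.comp_add_right x).norm
  have h3 : Real.pi * ‖g x‖ ≤ ∫ z : ℂ, ((Metric.ball (0 : ℂ) 1).indicator (fun z ↦ ‖z‖⁻¹) z * M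
      + ‖D (z + x)‖) := by
    have : Real.pi * ‖g x‖ = ‖∫ z : ℂ, z⁻¹ • D (z + x)‖ := by
      rw [h1]; simp [abs_of_pos Real.pi_pos]
    rw [this]
    refine norm_integral_le_of_norm_le (hi1.add hi2) (.of_forall fun z ↦ ?_)
    have h4 : ‖D (z + x)‖ ≤ M := SchwartzMap.norm_le_seminorm ℝ D _
    rw [norm_smul, norm_inv]
    by_cases hz : z ∈ Metric.ball (0 : ℂ) 1
    · rw [indicator_of_mem hz]
      have : ‖z‖⁻¹ * ‖D (z + x)‖ ≤ ‖z‖⁻¹ * M := by gcongr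
      linarith [norm_nonneg (D (z + x))]
    · rw [indicator_of_notMem hz, zero_mul, zero_add]
      refine mul_le_of_le_one_left (norm_nonneg _) (inv_le_one_of_one_le₀ ?_)
      simpa using hz
  rw [integral_add hi1 hi2, integral_mul_const, integral_indicator measurableSet_ball,
    integral_add_right_eq_self (fun z ↦ ‖D z‖), ← SchwartzMap.norm_toLp_one] at h3
  refine le_trans ?_ h3
  exact le_mul_of_one_le_left (norm_nonneg _) (by linarith [Real.pi_gt_three])

lemma dbarFun_mul_of_differentiableAt {u φ : ℂ → ℂ} {z : ℂ} (hu : DifferentiableAt ℂ u z)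
    (hφ : DifferentiableAt ℝ φ z) :
    dbarFun (fun w ↦ u w * φ w) z = u z * dbarFun φ z := by
  have h : fderiv ℝ (fun w ↦ u w * φ w) z = _ :=
    ((hu.hasDerivAt.hasFDerivAt.restrictScalars ℝ).mul hφ.hasFDerivAt).fderiv
  simp only [dbarFun, h]
  simp
  linear_combination (1 / 2 * φ z * _root_.deriv u z) * I_mul_I

lemma hasTemperateGrowth_pow (k : ℕ) : (fun z : ℂ ↦ z ^ k).HasTemperateGrowth := by
  fun_prop

lemma dbarSchwartz_smulLeft_pow (k : ℕ) (φ : 𝓢(ℂ, ℂ)) :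
    dbarSchwartz ℂ (SchwartzMap.smulLeftCLM ℂ (fun z : ℂ ↦ z ^ k) φ) =
      SchwartzMap.smulLeftCLM ℂ (fun z : ℂ ↦ z ^ k) (dbarSchwartz ℂ φ) := by
  ext z
  have h : (SchwartzMap.smulLeftCLM ℂ (fun z : ℂ ↦ z ^ k) φ : ℂ → ℂ) = fun z ↦ z ^ k * φ z := by
    ext w; simp [SchwartzMap.smulLeftCLM_apply_apply (hasTemperateGrowth_pow k)]
  rw [dbarSchwartz_apply, SchwartzMap.smulLeftCLM_apply_apply (hasTemperateGrowth_pow k),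
    dbarSchwartz_apply, h, dbarFun_mul_of_differentiableAt (by fun_prop) φ.differentiableAt,
    smul_eq_mul]

/-- By symmetry of the second derivative. This carries estimates for `φ` over to its derivatives. -/
lemma dbarSchwartz_lineDerivOp (v : ℂ) (φ : 𝓢(ℂ, ℂ)) :
    dbarSchwartz ℂ (LineDeriv.lineDerivOp v φ) = LineDeriv.lineDerivOp v (dbarSchwartz ℂ φ) := by
  have h (a b : ℂ) : LineDeriv.lineDerivOp a (LineDeriv.lineDerivOp b φ) =
      LineDeriv.lineDerivOp b (LineDeriv.lineDerivOp a φ) := by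
    ext z
    have hs : IsSymmSndFDerivAt ℝ φ z :=
      (φ.contDiffAt 2).isSymmSndFDerivAt (by simp)
    have hd : DifferentiableAt ℝ (fderiv ℝ φ) z :=
      ((φ.smooth 2).fderiv_right (m := 1) (by norm_num)).differentiable (by simp) z
    have h1 (a b : ℂ) : LineDeriv.lineDerivOp a (LineDeriv.lineDerivOp b φ) z =
        fderiv ℝ (fderiv ℝ φ) z a b := by
      rw [SchwartzMap.lineDerivOp_apply_eq_fderiv]
      have : (LineDeriv.lineDerivOp b φ : ℂ → ℂ) = fun w ↦ fderiv ℝ φ w b := by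
        ext w; rw [SchwartzMap.lineDerivOp_apply_eq_fderiv]
      rw [this, fderiv_clm_apply hd (by fun_prop)]
      simp
    rw [h1, h1, hs.eq]
  simp only [dbarSchwartz, FunLike.coe_smul, FunLike.coe_add, Pi.smul_apply, Pi.add_apply, 
    LineDeriv.lineDerivOpCLM_apply, LineDeriv.lineDerivOp_add, LineDeriv.lineDerivOp_smul, h v]

/-- The differential is `∂₁φ · re + ∂_Iφ · im`, and both coordinate forms have norm at most one.
Inductions on the order of differentiation thus stay among scalar Schwartz functions. -/
lemma seminorm_succ_le (k n : ℕ) (φ : 𝓢(ℂ, ℂ)) :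
    SchwartzMap.seminorm ℝ k (n + 1) φ ≤
      SchwartzMap.seminorm ℝ k n (LineDeriv.lineDerivOp (1 : ℂ) φ) +
        SchwartzMap.seminorm ℝ k n (LineDeriv.lineDerivOp I φ) := by
  refine SchwartzMap.seminorm_le_bound ℝ k (n + 1) φ (by positivity) fun x ↦ ?_
  set A : ℂ →L[ℝ] ℂ →L[ℝ] ℂ := ContinuousLinearMap.smulRightL ℝ ℂ ℂ reCLM
  set B : ℂ →L[ℝ] ℂ →L[ℝ] ℂ := ContinuousLinearMap.smulRightL ℝ ℂ ℂ imCLM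
  have hA : ‖A‖ ≤ 1 := A.opNorm_le_bound (by simp) fun w ↦ by simp [A]
  have hB : ‖B‖ ≤ 1 := B.opNorm_le_bound (by simp) fun w ↦ by simp [B]
  set f := LineDeriv.lineDerivOp (1 : ℂ) φ
  set g := LineDeriv.lineDerivOp I φ
  have hfd : fderiv ℝ φ = (A ∘ f) + (B ∘ g) := by
    ext z w
    have : w = w.re • (1 : ℂ) + w.im • I := by simp
    conv_lhs => rw [this, map_add, map_smul, map_smul]
    simp [A, B, f, g, SchwartzMap.lineDerivOp_apply_eq_fderiv]
  have h1 : ‖iteratedFDeriv ℝ (n + 1) φ x‖ ≤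
      ‖iteratedFDeriv ℝ n f x‖ + ‖iteratedFDeriv ℝ n g x‖ := by
    rw [← norm_iteratedFDeriv_fderiv, hfd, iteratedFDeriv_add_apply
      (A.contDiff.comp (f.smooth n)).contDiffAt (B.contDiff.comp (g.smooth n)).contDiffAt]
    refine (norm_add_le _ _).trans (add_le_add ?_ ?_)
    · refine (A.norm_iteratedFDeriv_comp_left (f.smooth n).contDiffAt le_rfl).trans ?_
      exact mul_le_of_le_one_left (norm_nonneg _) hA
    · refine (B.norm_iteratedFDeriv_comp_left (g.smooth n).contDiffAt le_rfl).trans ?_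
      exact mul_le_of_le_one_left (norm_nonneg _) hB
  have h2 := SchwartzMap.le_seminorm ℝ k n f x
  have h3 := SchwartzMap.le_seminorm ℝ k n g x
  calc _ ≤ ‖x‖ ^ k * (‖iteratedFDeriv ℝ n f x‖ + ‖iteratedFDeriv ℝ n g x‖) := by gcongr
    _ ≤ _ := by rw [mul_add]; exact add_le_add h2 h3

lemma continuous_seminorm (k n : ℕ) :
    Continuous (SchwartzMap.seminorm ℝ k n : Seminorm ℝ 𝓢(ℂ, ℂ)) :=
  (schwartz_withSeminorms ℝ ℂ ℂ).continuous_seminorm (k, n)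

/-- The Schwartz seminorms of a function are controlled by continuous seminorms of its image by the
Cauchy–Riemann operator. -/
lemma exists_seminorm_le_dbarSchwartz (k n : ℕ) :
    ∃ q : 𝓢(ℂ, ℂ) → ℝ, Continuous q ∧ q 0 = 0 ∧
      ∀ φ, SchwartzMap.seminorm ℝ k n φ ≤ q (dbarSchwartz ℂ φ) := by
  induction n with
  | zero =>
    obtain ⟨C, hC, h⟩ := exists_norm_le_dbarSchwartz
    -- The weight `‖z‖ ^ k` is the modulus of the holomorphic `z ^ k`, and multiplication by the
    -- latter commutes with `∂̄`. The supremum estimate is applied to `z ^ k φ`.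
    set P : 𝓢(ℂ, ℂ) →L[ℂ] 𝓢(ℂ, ℂ) := SchwartzMap.smulLeftCLM ℂ (fun z : ℂ ↦ z ^ k)
    refine ⟨fun ψ ↦ C * SchwartzMap.seminorm ℝ 0 0 (P ψ) +
      ‖SchwartzMap.toLpCLM ℂ ℂ 1 volume (P ψ)‖, ?_, ?_, fun φ ↦ ?_⟩
    · have := (continuous_seminorm 0 0).comp P.continuous
      have h2 := (SchwartzMap.toLpCLM ℂ ℂ 1 volume).continuous.comp P.continuous
      exact (this.const_mul C).add h2.norm
    · simp only [map_zero, norm_zero, mul_zero, add_zero]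
    · refine SchwartzMap.seminorm_le_bound ℝ k 0 φ (by positivity) fun x ↦ ?_
      have h1 := h (P φ) x
      rw [dbarSchwartz_smulLeft_pow] at h1
      refine le_trans (le_of_eq ?_) h1
      simp [P, SchwartzMap.smulLeftCLM_apply_apply (hasTemperateGrowth_pow k)]
  | succ n ih =>
    obtain ⟨q, hq, hq0, h⟩ := ih
    refine ⟨fun ψ ↦ q (LineDeriv.lineDerivOpCLM ℂ 𝓢(ℂ, ℂ) (1 : ℂ) ψ) +
      q (LineDeriv.lineDerivOpCLM ℂ 𝓢(ℂ, ℂ) I ψ), by fun_prop, by simp [hq0], fun φ ↦ ?_⟩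
    refine (seminorm_succ_le k n φ).trans (add_le_add ?_ ?_)
    · simpa [dbarSchwartz_lineDerivOp] using h (LineDeriv.lineDerivOp (1 : ℂ) φ)
    · simpa [dbarSchwartz_lineDerivOp] using h (LineDeriv.lineDerivOp I φ)

/-- The Cauchy–Riemann operator is surjective on tempered distributions. -/
theorem exists_comp_dbarSchwartz_eq (τ : 𝓢'(ℂ, ℂ)) :
    ∃ σ : 𝓢'(ℂ, ℂ), ∀ φ, σ (dbarSchwartz ℂ φ) = τ φ := by
  set D := (dbarSchwartz ℂ).toLinearMap
  have hinj : Function.Injective D := by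
    refine (injective_iff_map_eq_zero D).2 fun φ hφ ↦ ?_
    obtain ⟨q, -, hq0, hq⟩ := exists_seminorm_le_dbarSchwartz 0 0
    ext x
    have h1 := hq φ
    rw [show dbarSchwartz ℂ φ = 0 from hφ, hq0] at h1
    have h2 := SchwartzMap.norm_le_seminorm ℝ φ x
    simpa using h2.trans h1
  set e := LinearEquiv.ofInjective D hinj
  -- The estimates say that the inverse of `∂̄` is continuous on its range, so `τ` composed with it
  -- is a continuous functional there, ready for Hahn–Banach.
  have he : Continuous e.symm := by
    refine continuous_of_continuousAt_zero e.symm ?_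
    rw [ContinuousAt, map_zero, (schwartz_withSeminorms ℝ ℂ ℂ).tendsto_nhds]
    rintro ⟨k, n⟩ ε hε
    obtain ⟨q, hqc, hq0, hq⟩ := exists_seminorm_le_dbarSchwartz k n
    have h1 : Tendsto (fun s : LinearMap.range D ↦ q s) (𝓝 0) (𝓝 0) := by
      have : Continuous fun s : LinearMap.range D ↦ q s := hqc.comp continuous_subtype_val
      simpa [hq0] using this.tendsto 0
    filter_upwards [h1.eventually_lt_const hε] with s hs
    rw [sub_zero]
    refine (hq _).trans_lt ?_
    have : dbarSchwartz ℂ (e.symm s) = s := congrArg Subtype.val (e.apply_symm_apply s)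
    rwa [this]
  have : PolynormableSpace ℂ 𝓢(ℂ, ℂ) := (schwartz_withSeminorms ℂ ℂ ℂ).toPolynormableSpace
  obtain ⟨g, hg⟩ := StrongDual.exists_extension (LinearMap.range D)
    ⟨τ.toLinearMap ∘ₗ e.symm.toLinearMap, τ.continuous.comp he⟩
  refine ⟨ContinuousLinearMap.toPointwiseConvergenceCLM _ _ _ _ g, fun φ ↦ ?_⟩
  have h1 := hg (e φ)
  have h2 : ((e φ : LinearMap.range D) : 𝓢(ℂ, ℂ)) = dbarSchwartz ℂ φ := rfl
  rw [h2] at h1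
  refine h1.trans (congrArg τ (e.symm_apply_apply φ))

end Division

end

end TempMeril

namespace TempMeril

noncomputable section

open MeasureTheory Set Filter Topology Complex
open scoped Convolution Pointwise

/-! ### Regularisation of tempered distributions by convolution with a compactly supported kernel.
-/

section Convolution

/-- The convolution of a smooth function with compact support and of an integrable function with
compact support, as a Schwartz function. -/
def convSchwartz {k : 𝓢(ℂ, ℂ)} (hk : HasCompactSupport k) {g : ℂ → ℂ} (hg : Integrable g)
    (hgc : HasCompactSupport g) : 𝓢(ℂ, ℂ) :=
  (hgc.convolution (ContinuousLinearMap.mul ℝ ℂ) hk (μ := volume)).toSchwartzMap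
    (hk.contDiff_convolution_right (ContinuousLinearMap.mul ℝ ℂ) hg.locallyIntegrable k.smooth')

lemma convSchwartz_apply {k : 𝓢(ℂ, ℂ)} (hk : HasCompactSupport k) {g : ℂ → ℂ} (hg : Integrable g)
    (hgc : HasCompactSupport g) (x : ℂ) :
    convSchwartz hk hg hgc x = ∫ t, g t * k (x - t) := rfl

lemma hasCompactSupport_convSchwartz {k : 𝓢(ℂ, ℂ)} (hk : HasCompactSupport k) {g : ℂ → ℂ}
    (hg : Integrable g) (hgc : HasCompactSupport g) :
    HasCompactSupport (convSchwartz hk hg hgc) :=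
  hgc.convolution (ContinuousLinearMap.mul ℝ ℂ) hk (μ := volume)

lemma tsupport_convSchwartz_subset {k : 𝓢(ℂ, ℂ)} (hk : HasCompactSupport k) {g : ℂ → ℂ}
    (hg : Integrable g) (hgc : HasCompactSupport g) :
    tsupport (convSchwartz hk hg hgc) ⊆ tsupport g + tsupport k := by
  refine closure_minimal ?_ (hgc.isCompact.add hk.isCompact).isClosed
  refine (support_convolution_subset (ContinuousLinearMap.mul ℝ ℂ) (μ := volume)).trans ?_
  exact Set.add_subset_add subset_closure subset_closure

lemma hasCompactSupport_lineDerivOp {k : 𝓢(ℂ, ℂ)} (hk : HasCompactSupport k) (v : ℂ) :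
    HasCompactSupport (LineDeriv.lineDerivOp v k : 𝓢(ℂ, ℂ)) :=
  hk.isCompact.of_isClosed_subset (isClosed_tsupport _) (SchwartzMap.tsupport_lineDerivOp_subset v k)

lemma tsupport_dbarSchwartz_subset (k : 𝓢(ℂ, ℂ)) : tsupport (dbarSchwartz ℂ k) ⊆ tsupport k := by
  refine closure_minimal (fun x hx ↦ ?_) (isClosed_tsupport _)
  contrapose! hx
  have (v : ℂ) : (LineDeriv.lineDerivOp v k : 𝓢(ℂ, ℂ)) x = 0 :=
    image_eq_zero_of_notMem_tsupport fun h ↦ hx (SchwartzMap.tsupport_lineDerivOp_subset v k h)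
  simp [dbarSchwartz, this]

lemma hasCompactSupport_dbarSchwartz {k : 𝓢(ℂ, ℂ)} (hk : HasCompactSupport k) :
    HasCompactSupport (dbarSchwartz ℂ k) :=
  hk.isCompact.of_isClosed_subset (isClosed_tsupport _) (tsupport_dbarSchwartz_subset k)

lemma lineDerivOp_convSchwartz {k : 𝓢(ℂ, ℂ)} (hk : HasCompactSupport k) {g : ℂ → ℂ}
    (hg : Integrable g) (hgc : HasCompactSupport g) (v : ℂ) :
    LineDeriv.lineDerivOp v (convSchwartz hk hg hgc) =
      convSchwartz (hasCompactSupport_lineDerivOp hk v) hg hgc := by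
  ext x
  have h1 : fderiv ℝ (convSchwartz hk hg hgc) x = _ :=
    (hk.hasFDerivAt_convolution_right (ContinuousLinearMap.mul ℝ ℂ) hg.locallyIntegrable
      (k.smooth 1) x).fderiv
  rw [SchwartzMap.lineDerivOp_apply_eq_fderiv, h1, convolution_precompR_apply _
    hg.locallyIntegrable (hk.fderiv ℝ) ((k.smooth 1).continuous_fderiv (by simp))]
  rfl

lemma integrable_mul_comp_sub {k : 𝓢(ℂ, ℂ)} (hk : HasCompactSupport k) {g : ℂ → ℂ}
    (hg : Integrable g) (x : ℂ) : Integrable fun t ↦ g t * k (x - t) :=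
  hk.convolutionExists_right (ContinuousLinearMap.mul ℝ ℂ) hg.locallyIntegrable k.continuous x

lemma dbarSchwartz_convSchwartz {k : 𝓢(ℂ, ℂ)} (hk : HasCompactSupport k) {g : ℂ → ℂ}
    (hg : Integrable g) (hgc : HasCompactSupport g) :
    dbarSchwartz ℂ (convSchwartz hk hg hgc) =
      convSchwartz (hasCompactSupport_dbarSchwartz hk) hg hgc := by
  ext x
  simp only [dbarSchwartz, FunLike.coe_smul, FunLike.coe_add, Pi.smul_apply, Pi.add_apply,
    LineDeriv.lineDerivOpCLM_apply, lineDerivOp_convSchwartz, convSchwartz_apply, smul_eq_mul]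
  have h (v : ℂ) := integrable_mul_comp_sub (hasCompactSupport_lineDerivOp hk v) hg x
  rw [← integral_const_mul, ← integral_add (h 1) ((h I).const_mul I), ← integral_const_mul]
  congr 1 with t
  ring

/-- All derivatives fall on `k`, so the `L¹` norm of `g` is enough; the factor `‖x‖ ^ m` is bounded
on the compact set `K + tsupport k`. -/
lemma exists_seminorm_convSchwartz_le {K : Set ℂ} (hK : IsCompact K) (m n : ℕ) {k : 𝓢(ℂ, ℂ)}
    (hk : HasCompactSupport k) :
    ∃ C : ℝ, ∀ {g : ℂ → ℂ} (hg : Integrable g) (hgc : HasCompactSupport g), tsupport g ⊆ K →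
      SchwartzMap.seminorm ℝ m n (convSchwartz hk hg hgc) ≤ C * ∫ z, ‖g z‖ := by
  induction n generalizing k with
  | zero =>
    obtain ⟨R, hR⟩ := (hK.add hk.isCompact).isBounded.exists_norm_le
    refine ⟨|R| ^ m * SchwartzMap.seminorm ℝ 0 0 k, fun {g} hg hgc hgK ↦ ?_⟩
    refine SchwartzMap.seminorm_le_bound ℝ m 0 _ (by positivity) fun x ↦ ?_
    rw [norm_iteratedFDeriv_zero]
    by_cases hx : x ∈ tsupport (convSchwartz hk hg hgc)
    · have h1 : ‖x‖ ≤ |R| := (hR x <| Set.add_subset_add_right hgK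
        (tsupport_convSchwartz_subset hk hg hgc hx)).trans (le_abs_self R)
      have h2 : ‖convSchwartz hk hg hgc x‖ ≤ ∫ z, SchwartzMap.seminorm ℝ 0 0 k * ‖g z‖ := by
        rw [convSchwartz_apply]
        refine norm_integral_le_of_norm_le (hg.norm.const_mul _) (.of_forall fun t ↦ ?_)
        rw [norm_mul, mul_comm]
        gcongr
        exact SchwartzMap.norm_le_seminorm ℝ k _
      rw [integral_const_mul] at h2
      calc _ ≤ |R| ^ m * (SchwartzMap.seminorm ℝ 0 0 k * ∫ z, ‖g z‖) := by gcongr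
        _ = _ := by ring
    · rw [image_eq_zero_of_notMem_tsupport hx]
      simp only [norm_zero, mul_zero]
      positivity
  | succ n ih =>
    obtain ⟨C₁, h₁⟩ := ih (hasCompactSupport_lineDerivOp hk 1)
    obtain ⟨C₂, h₂⟩ := ih (hasCompactSupport_lineDerivOp hk I)
    refine ⟨C₁ + C₂, fun {g} hg hgc hgK ↦ (seminorm_succ_le m n _).trans ?_⟩
    rw [lineDerivOp_convSchwartz, lineDerivOp_convSchwartz, add_mul]
    exact add_le_add (h₁ hg hgc hgK) (h₂ hg hgc hgK)

/-- Convolution followed by a tempered distribution is given, on functions with support in a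
compact set, by an integrable function. -/
lemma exists_apply_convSchwartz_eq_integral (τ : 𝓢'(ℂ, ℂ)) {K : Set ℂ} (hK : IsCompact K)
    {k : 𝓢(ℂ, ℂ)} (hk : HasCompactSupport k) :
    ∃ v : ℂ → ℂ, Integrable v ∧ HasCompactSupport v ∧
      ∀ (φ : 𝓢(ℂ, ℂ)) (hφ : HasCompactSupport φ), tsupport φ ⊆ K →
        τ (convSchwartz hk φ.integrable hφ) = ∫ z, v z * φ z := by
  have hKm := hK.measurableSet
  set μ : Measure ℂ := volume.restrict K with hμ
  have : IsFiniteMeasure μ := ⟨by simpa [hμ] using hK.measure_lt_top⟩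
  have hint (g : Lp ℂ 2 μ) : Integrable g μ := (Lp.memLp g).integrable (by norm_num)
  have hind (g : Lp ℂ 2 μ) : Integrable (K.indicator g) :=
    (integrable_indicator_iff hKm).2 (hint g)
  have hindK (g : Lp ℂ 2 μ) : tsupport (K.indicator g) ⊆ K :=
    closure_minimal Set.support_indicator_subset hK.isClosed
  have hindc (g : Lp ℂ 2 μ) : HasCompactSupport (K.indicator g) :=
    hK.of_isClosed_subset (isClosed_tsupport _) (hindK g)
  have happ (g : Lp ℂ 2 μ) (x : ℂ) :
      convSchwartz hk (hind g) (hindc g) x = ∫ t, g t * k (x - t) ∂μ := by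
    rw [convSchwartz_apply, ← integral_indicator hKm]
    congr 1 with t
    by_cases ht : t ∈ K <;> simp [ht]
  have hint2 (g : Lp ℂ 2 μ) (x : ℂ) : Integrable (fun t ↦ g t * k (x - t)) μ := by
    refine (hint g).mul_bdd (c := SchwartzMap.seminorm ℝ 0 0 k) ?_ ?_
    · exact (k.continuous.comp (by fun_prop)).aestronglyMeasurable
    · exact .of_forall fun t ↦ SchwartzMap.norm_le_seminorm ℝ k _
  -- Convolution with `k` is extended from test functions to `L²(K)`. Composing with `τ` gives a
  -- continuous functional on a Hilbert space, and the Riesz representation supplies the density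
  -- `v`.
  set T : Lp ℂ 2 μ →ₗ[ℂ] 𝓢(ℂ, ℂ) :=
    { toFun g := convSchwartz hk (hind g) (hindc g)
      map_add' g h := by
        ext x
        rw [add_apply, happ, happ, happ, ← integral_add (hint2 g x) (hint2 h x)]
        refine integral_congr_ae ?_
        filter_upwards [Lp.coeFn_add g h] with t ht
        rw [ht, Pi.add_apply, add_mul]
      map_smul' a g := by
        ext x
        rw [smul_apply, happ, RingHom.id_apply, happ, smul_eq_mul,
          ← integral_const_mul]
        refine integral_congr_ae ?_
        filter_upwards [Lp.coeFn_smul a g] with t ht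
        rw [ht, Pi.smul_apply, smul_eq_mul, mul_assoc] } with hT
  have hL1 (g : Lp ℂ 2 μ) : ∫ z, ‖K.indicator g z‖ ≤ (μ.real univ) ^ (1 / 2 : ℝ) * ‖g‖ := by
    have h1 : ∫ z, ‖K.indicator g z‖ = ∫ z, ‖g z‖ ∂μ := by
      simp_rw [norm_indicator_eq_indicator_norm]
      rw [integral_indicator hKm]
    have h2 := eLpNorm_le_eLpNorm_mul_rpow_measure_univ (μ := μ) (p := 1) (q := 2) (by norm_num)
      (Lp.aestronglyMeasurable g)
    have h3 := ENNReal.toReal_mono (ENNReal.mul_ne_top (Lp.eLpNorm_ne_top g)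
      (ENNReal.rpow_ne_top_of_nonneg (by norm_num) (measure_ne_top μ univ))) h2
    rw [h1, integral_norm_eq_lintegral_enorm (Lp.aestronglyMeasurable g),
      ← eLpNorm_one_eq_lintegral_enorm]
    refine h3.trans_eq ?_
    rw [ENNReal.toReal_mul, mul_comm, Lp.norm_def, ← ENNReal.toReal_rpow, Measure.real]
    norm_num
  have hTc : Continuous T := by
    refine continuous_of_continuousAt_zero T ?_
    rw [ContinuousAt, map_zero, (schwartz_withSeminorms ℝ ℂ ℂ).tendsto_nhds]
    rintro ⟨m, n⟩ ε hε
    obtain ⟨C, hC⟩ := exists_seminorm_convSchwartz_le hK m n hk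
    have h1 : Tendsto (fun g : Lp ℂ 2 μ ↦ |C| * ((μ.real univ) ^ (1 / 2 : ℝ) * ‖g‖))
        (𝓝 0) (𝓝 0) := by
      have : Continuous (fun g : Lp ℂ 2 μ ↦ |C| * ((μ.real univ) ^ (1 / 2 : ℝ) * ‖g‖)) := by
        fun_prop
      simpa using this.tendsto 0
    filter_upwards [h1.eventually_lt_const hε] with g hg
    rw [sub_zero]
    refine lt_of_le_of_lt ?_ hg
    refine (hC (hind g) (hindc g) (hindK g)).trans ?_
    calc _ ≤ |C| * ∫ z, ‖K.indicator g z‖ := by gcongr; exact le_abs_self C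
      _ ≤ _ := by gcongr; exact hL1 g
  set f := (InnerProductSpace.toDual ℂ (Lp ℂ 2 μ)).symm
    ⟨τ.toLinearMap ∘ₗ T, τ.continuous.comp hTc⟩ with hf
  -- The conjugate turns the sesquilinear inner product into the bilinear pairing `∫ v φ`.
  refine ⟨K.indicator fun z ↦ (starRingEnd ℂ) (f z), ?_, ?_, fun φ hφ hφK ↦ ?_⟩
  · refine (integrable_indicator_iff hKm).2 ?_
    exact (LinearIsometryEquiv.integrable_comp_iff conjLIE).2 (hint f)
  · exact hK.of_isClosed_subset (isClosed_tsupport _)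
      (closure_minimal Set.support_indicator_subset hK.isClosed)
  · have hφ2 : MemLp φ 2 μ := (φ.memLp 2 volume).restrict K
    have h1 : T hφ2.toLp = convSchwartz hk φ.integrable hφ := by
      ext x
      refine (happ _ x).trans ?_
      have h2 : ∫ t, φ t * k (x - t) ∂μ = ∫ t, φ t * k (x - t) := by
        refine setIntegral_eq_integral_of_forall_compl_eq_zero fun t ht ↦ ?_
        rw [image_eq_zero_of_notMem_tsupport fun h ↦ ht (hφK h), zero_mul]
      rw [convSchwartz_apply, ← h2]
      refine integral_congr_ae ?_
      filter_upwards [hφ2.coeFn_toLp] with t ht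
      rw [ht]
    have h2 : inner ℂ f hφ2.toLp = τ (T hφ2.toLp) := by
      rw [hf, InnerProductSpace.toDual_symm_apply]
      rfl
    have h3 : ∫ z, K.indicator (fun z ↦ (starRingEnd ℂ) (f z)) z * φ z =
        ∫ z, K.indicator (fun z ↦ (starRingEnd ℂ) (f z)) z * φ z ∂μ :=
      (setIntegral_eq_integral_of_forall_compl_eq_zero fun z hz ↦ by
        rw [indicator_of_notMem hz, zero_mul]).symm
    rw [← h1, ← h2, L2.inner_def, h3]
    refine integral_congr_ae ?_
    filter_upwards [hφ2.coeFn_toLp, ae_restrict_mem hKm] with z hz hzK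
    rw [hz, indicator_of_mem hzK, RCLike.inner_apply, mul_comm]

end Convolution

/-! ### The smooth mean value kernel and the parametrix of `∂̄`. -/

section Kernel

/-- A smooth cutoff function, equal to one near the origin and supported in the disc of
radius `δ`. -/
lemma exists_cutoff {δ : ℝ} (hδ : 0 < δ) :
    ∃ χ : 𝓢(ℂ, ℂ), tsupport χ ⊆ Metric.closedBall 0 δ ∧ HasCompactSupport χ ∧ χ =ᶠ[𝓝 0] 1 := by
  let b : ContDiffBump (0 : ℂ) := ⟨δ / 2, δ, by positivity, by linarith⟩
  have hc : HasCompactSupport fun z ↦ (b z : ℂ) :=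
    b.hasCompactSupport.comp_left (g := ((↑) : ℝ → ℂ)) (by simp)
  have hd : ContDiff ℝ (⊤ : ℕ∞) fun z ↦ (b z : ℂ) := ofRealCLM.contDiff.comp b.contDiff
  have ht : tsupport (fun z ↦ (b z : ℂ)) ⊆ Metric.closedBall 0 δ := by
    refine (tsupport_comp_subset (g := ((↑) : ℝ → ℂ)) (by simp) b).trans ?_
    exact b.tsupport_eq.subset
  refine ⟨hc.toSchwartzMap hd, ht, hc, ?_⟩
  filter_upwards [b.eventuallyEq_one] with z hz
  change (b z : ℂ) = 1
  simp [hz]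

/-- Division of a Schwartz function vanishing near the origin by a multiple of the coordinate. -/
lemma exists_inv_mul_eq {h : 𝓢(ℂ, ℂ)} (hc : HasCompactSupport h) (h0 : h =ᶠ[𝓝 0] 0) (a : ℂ) :
    ∃ k : 𝓢(ℂ, ℂ), tsupport k ⊆ tsupport h ∧ ∀ z, k z = a * z⁻¹ * h z := by
  have hd : ContDiff ℝ (⊤ : ℕ∞) fun z ↦ a * z⁻¹ * h z := by
    rw [contDiff_iff_contDiffAt]
    intro z
    by_cases hz : z = 0
    · have : (fun z ↦ a * z⁻¹ * h z) =ᶠ[𝓝 z] fun _ ↦ 0 := by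
        rw [hz]
        filter_upwards [h0] with w hw
        simp [hw]
      exact contDiffAt_const.congr_of_eventuallyEq this
    · exact (contDiffAt_const.mul (contDiffAt_id.inv hz)).mul (h.smooth _).contDiffAt
  refine ⟨(hc.mul_left (f := fun z ↦ a * z⁻¹)).toSchwartzMap hd, ?_, fun z ↦ rfl⟩
  exact tsupport_mul_subset_right

lemma integrable_inv_mul {h : 𝓢(ℂ, ℂ)} (hc : HasCompactSupport h) (a : ℂ) :
    Integrable fun z ↦ a * z⁻¹ * h z := by
  obtain ⟨R, hR⟩ := hc.isCompact.isBounded.subset_ball 0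
  have h1 : IntegrableOn (fun z : ℂ ↦ a * z⁻¹) (Metric.ball 0 R) := by
    refine Integrable.const_mul ?_ a
    refine (integrableOn_ball_norm_inv R).mono' (by fun_prop) (.of_forall fun z ↦ by simp)
  have h2 : IntegrableOn (fun z ↦ a * z⁻¹ * h z) (Metric.ball 0 R) :=
    Integrable.mul_bdd (c := SchwartzMap.seminorm ℝ 0 0 h) h1
      h.continuous.aestronglyMeasurable (.of_forall fun z ↦ SchwartzMap.norm_le_seminorm ℝ h z)
  refine (integrableOn_iff_integrable_of_support_subset fun z hz ↦ hR ?_).1 h2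
  exact subset_closure (right_ne_zero_of_mul hz)

lemma dbarFun_mul {f g : ℂ → ℂ} {z : ℂ} (hf : DifferentiableAt ℝ f z)
    (hg : DifferentiableAt ℝ g z) :
    dbarFun (fun w ↦ f w * g w) z = dbarFun f z * g z + f z * dbarFun g z := by
  have h : fderiv ℝ (fun w ↦ f w * g w) z = _ := (hf.hasFDerivAt.mul hg.hasFDerivAt).fderiv
  simp only [dbarFun, h]
  simp
  ring

lemma dbarFun_comp_const_sub {g : ℂ → ℂ} {x z : ℂ} (hg : DifferentiableAt ℝ g (x - z)) :
    dbarFun (fun w ↦ g (x - w)) z = -dbarFun g (x - z) := by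
  have h : fderiv ℝ (fun w ↦ g (x - w)) z = _ :=
    (hg.hasFDerivAt.comp z ((hasFDerivAt_id z).const_sub x)).fderiv
  simp only [dbarFun, h]
  simp
  ring

/-- The mean value kernel of radius `δ`, with its representation formulas. -/
lemma exists_kernel {δ : ℝ} (hδ : 0 < δ) :
    ∃ (k : 𝓢(ℂ, ℂ)) (P : ℂ → ℂ), tsupport k ⊆ Metric.closedBall 0 δ ∧
      tsupport P ⊆ Metric.closedBall 0 δ ∧ Integrable P ∧
      (∀ φ : 𝓢(ℂ, ℂ), ∀ x, φ x = (∫ t, k t * φ (x - t)) +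
        ∫ t, P t * dbarSchwartz ℂ φ (x - t)) ∧
      ∀ (u : ℂ → ℂ) (z : ℂ) (r : ℝ), δ < r → DifferentiableOn ℂ u (Metric.ball z r) →
        u z = ∫ w, k (w - z) * u w := by
  obtain ⟨χ, hχs, hχc, hχ1⟩ := exists_cutoff hδ
  have h0 : dbarSchwartz ℂ χ =ᶠ[𝓝 0] 0 := by
    filter_upwards [hχ1.eventuallyEq_nhds] with z hz
    rw [dbarSchwartz_apply, dbarFun, hz.fderiv_eq]
    simp [Pi.one_def]
  have hπ : (Real.pi : ℂ) ≠ 0 := by exact_mod_cast Real.pi_ne_zero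
  -- Here `k = -(πz)⁻¹ ∂̄χ`, which is smooth because `χ` is constant near the origin, and `P =
  -- (πz)⁻¹ χ`. The two formulas are Cauchy–Pompeiu for `χ(t) φ(x - t)` and for `χ(t) u(z + t)`; in
  -- the second, holomorphy of `u` removes the `P` term.
  obtain ⟨k, hks, hk⟩ := exists_inv_mul_eq (hasCompactSupport_dbarSchwartz hχc) h0
    (-(Real.pi : ℂ)⁻¹)
  have hks' : tsupport k ⊆ Metric.closedBall 0 δ :=
    (hks.trans (tsupport_dbarSchwartz_subset χ)).trans hχs
  refine ⟨k, fun z ↦ (Real.pi : ℂ)⁻¹ * z⁻¹ * χ z, hks', tsupport_mul_subset_right.trans hχs,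
    integrable_inv_mul hχc _, fun φ x ↦ ?_, fun u z r hr hu ↦ ?_⟩
  · have hd : ContDiff ℝ (⊤ : ℕ∞) fun t ↦ χ t * φ (x - t) :=
      χ.smooth'.mul (φ.smooth'.comp (contDiff_const.sub contDiff_id))
    have h1 := integral_inv_smul_dbarFun ((hχc.mul_right (f' := fun t ↦ φ (x - t))).toSchwartzMap hd)
    have h2 (t : ℂ) : dbarFun (fun t ↦ χ t * φ (x - t)) t =
        dbarSchwartz ℂ χ t * φ (x - t) + χ t * -dbarSchwartz ℂ φ (x - t) := by
      have h3 : DifferentiableAt ℝ (fun t ↦ φ (x - t)) t :=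
        φ.differentiableAt.comp t ((differentiableAt_const x).sub differentiableAt_id)
      rw [dbarFun_mul χ.differentiableAt h3, dbarFun_comp_const_sub φ.differentiableAt, dbarSchwartz_apply, dbarSchwartz_apply]
    have h3 : ∫ t, t⁻¹ • dbarFun (fun t ↦ χ t * φ (x - t)) t = -Real.pi * φ x := by
      refine h1.trans ?_
      simp [hχ1.eq_of_nhds]
    have hi {g : ℂ → ℂ} (hg : Integrable g) (ψ : 𝓢(ℂ, ℂ)) : Integrable fun t ↦ g t * ψ (x - t) :=
      hg.mul_bdd (c := SchwartzMap.seminorm ℝ 0 0 ψ)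
        (ψ.continuous.comp (by fun_prop)).aestronglyMeasurable
        (.of_forall fun t ↦ SchwartzMap.norm_le_seminorm ℝ ψ _)
    rw [← integral_add (hi k.integrable φ) (hi (integrable_inv_mul hχc _) _)]
    have h4 : φ x = ∫ t, -(Real.pi : ℂ)⁻¹ * (t⁻¹ • dbarFun (fun t ↦ χ t * φ (x - t)) t) := by
      rw [integral_const_mul, h3]
      field_simp
    rw [h4]
    congr 1 with t
    rw [h2, hk]
    simp only [smul_eq_mul]
    ring
  · have h5 (t : ℂ) : t ∈ tsupport χ → z + t ∈ Metric.ball z r := fun ht ↦ by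
      have := hχs ht
      simp only [Metric.mem_closedBall, dist_zero_right] at this
      simpa using this.trans_lt hr
    have h6 (t : ℂ) (ht : t ∉ tsupport χ) : (fun t ↦ χ t * u (z + t)) =ᶠ[𝓝 t] fun _ ↦ 0 := by
      filter_upwards [(isClosed_tsupport χ).isOpen_compl.mem_nhds ht] with w hw
      rw [image_eq_zero_of_notMem_tsupport hw, zero_mul]
    have hd : ContDiff ℝ (⊤ : ℕ∞) fun t ↦ χ t * u (z + t) := by
      rw [contDiff_iff_contDiffAt]
      intro t
      by_cases ht : t ∈ tsupport χ
      · have h7 : ContDiffAt ℂ (⊤ : ℕ∞) u (z + t) :=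
          (hu.contDiffOn Metric.isOpen_ball).contDiffAt (Metric.isOpen_ball.mem_nhds (h5 t ht))
        exact (χ.smooth _).contDiffAt.mul
          ((h7.restrict_scalars ℝ).comp t (contDiffAt_const.add contDiffAt_id))
      · exact contDiffAt_const.congr_of_eventuallyEq (h6 t ht)
    have h1 := integral_inv_smul_dbarFun ((hχc.mul_right (f' := fun t ↦ u (z + t))).toSchwartzMap hd)
    have h2 (t : ℂ) : dbarFun (fun t ↦ χ t * u (z + t)) t = dbarSchwartz ℂ χ t * u (z + t) := by
      by_cases ht : t ∈ tsupport χ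
      · have h7 : DifferentiableAt ℂ (fun t ↦ u (z + t)) t :=
          (hu.differentiableAt (Metric.isOpen_ball.mem_nhds (h5 t ht))).comp t (by fun_prop)
        have h8 : (fun t ↦ χ t * u (z + t)) = fun t ↦ u (z + t) * χ t := by
          ext; ring
        rw [h8, dbarFun_mul_of_differentiableAt h7 χ.differentiableAt, dbarSchwartz_apply, mul_comm]
      · rw [image_eq_zero_of_notMem_tsupport fun h ↦ ht (tsupport_dbarSchwartz_subset χ h), zero_mul,
          dbarFun, (h6 t ht).fderiv_eq]
        simp
    have h3 : ∫ t, t⁻¹ • dbarFun (fun t ↦ χ t * u (z + t)) t = -Real.pi * u z := by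
      refine h1.trans ?_
      simp [hχ1.eq_of_nhds]
    have h4 : u z = ∫ t, -(Real.pi : ℂ)⁻¹ * (t⁻¹ • dbarFun (fun t ↦ χ t * u (z + t)) t) := by
      rw [integral_const_mul, h3]
      field_simp
    rw [h4, ← integral_add_left_eq_self (fun w ↦ k (w - z) * u w) z]
    congr 1 with t
    rw [h2, hk, add_sub_cancel_left]
    simp only [smul_eq_mul]
    ring

end Kernel

end

end TempMeril

namespace TempMeril

noncomputable section

open MeasureTheory Set Filter Topology Complex
open scoped Convolution Pointwise

/-! ### Weyl's lemma and polynomial growth of tempered holomorphic functions. -/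

section Weyl

lemma eqOn_of_integral_eq {O : Set ℂ} (hO : IsOpen O) {f g : ℂ → ℂ} (hf : ContinuousOn f O)
    (hg : ContinuousOn g O) (h : ∀ φ : 𝓢(ℂ, ℂ), HasCompactSupport φ → tsupport φ ⊆ O →
      ∫ z, φ z * f z = ∫ z, φ z * g z) : EqOn f g O := by
  have hfg : LocallyIntegrableOn (fun z ↦ f z - g z) O :=
    (hf.sub hg).locallyIntegrableOn hO.measurableSet
  have h1 := hO.ae_eq_zero_of_integral_contDiff_smul_eq_zero hfg fun ρ hρ hρc hρO ↦ by
    have hc : HasCompactSupport fun z ↦ (ρ z : ℂ) :=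
      hρc.comp_left (g := ((↑) : ℝ → ℂ)) (by simp)
    have hs : tsupport (fun z ↦ (ρ z : ℂ)) ⊆ tsupport ρ :=
      tsupport_comp_subset (g := ((↑) : ℝ → ℂ)) (by simp) ρ
    have h2 := h (hc.toSchwartzMap (ofRealCLM.contDiff.comp hρ)) hc (hs.trans hρO)
    have hi {f : ℂ → ℂ} (hf : ContinuousOn f O) : Integrable fun z ↦ (ρ z : ℂ) * f z := by
      have hK : IntegrableOn (fun z ↦ (ρ z : ℂ) * f z) (tsupport ρ) := by
        refine ContinuousOn.integrableOn_compact hρc.isCompact ?_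
        exact (continuous_ofReal.comp hρ.continuous).continuousOn.mul (hf.mono hρO)
      refine (integrableOn_iff_integrable_of_support_subset fun z hz ↦ ?_).1 hK
      exact hs (subset_closure (left_ne_zero_of_mul hz))
    have h3 : ∫ z, (ρ z : ℂ) * f z = ∫ z, (ρ z : ℂ) * g z := h2
    have h4 (z : ℂ) : ρ z • (f z - g z) = (ρ z : ℂ) * f z - (ρ z : ℂ) * g z := by
      rw [real_smul]; ring
    simp_rw [h4]
    rw [integral_sub (hi hf) (hi hg), h3, sub_self]
  refine Measure.eqOn_open_of_ae_eq (μ := volume) ?_ hO hf hg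
  rw [Filter.EventuallyEq, ae_restrict_iff' hO.measurableSet]
  filter_upwards [h1] with z hz hzO
  exact sub_eq_zero.1 (hz hzO)

lemma differentiableAt_of_dbarFun_eq_zero {f : ℂ → ℂ} {z : ℂ} (hf : DifferentiableAt ℝ f z)
    (h : dbarFun f z = 0) : DifferentiableAt ℂ f z := by
  refine differentiableAt_complex_iff_differentiableAt_real.2 ⟨hf, ?_⟩
  simp only [dbarFun, smul_eq_mul] at h ⊢
  linear_combination (-2 * I) * h + (fderiv ℝ f z I) * I_mul_I

/-- A tempered distribution killed by the Cauchy–Riemann operator on an open set is given by a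
smooth function satisfying the Cauchy–Riemann equation, on any smaller compact set. -/
lemma exists_eq_integral_on_compact {τ : 𝓢'(ℂ, ℂ)} {U : Set ℂ}
    (hτ : ∀ φ : 𝓢(ℂ, ℂ), HasCompactSupport φ → tsupport φ ⊆ U → τ (dbarSchwartz ℂ φ) = 0)
    {K : Set ℂ} (hK : IsCompact K) {δ : ℝ} (hδ : 0 < δ)
    (hKU : K + Metric.closedBall 0 δ + Metric.closedBall 0 δ ⊆ U) :
    ∃ W : 𝓢(ℂ, ℂ), (∀ y ∈ K, dbarFun W y = 0) ∧
      ∀ φ : 𝓢(ℂ, ℂ), HasCompactSupport φ → tsupport φ ⊆ K → τ φ = ∫ z, φ z * W z := by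
  obtain ⟨k, P, hk, hP, hPi, hrep, -⟩ := exists_kernel hδ
  set B : Set ℂ := Metric.closedBall 0 δ
  have hB : IsCompact B := isCompact_closedBall _ _
  have hB0 : (0 : ℂ) ∈ B := by simp [B, hδ.le]
  have hkc : HasCompactSupport k := hB.of_isClosed_subset (isClosed_tsupport _) hk
  have hPc : HasCompactSupport P := hB.of_isClosed_subset (isClosed_tsupport _) hP
  have hKB : K + B ⊆ U := fun x hx ↦ hKU ⟨x, hx, 0, hB0, by simp⟩
  have hK1 : K ⊆ K + B := fun x hx ↦ ⟨x, hx, 0, hB0, by simp⟩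
  -- In `φ = k * φ + ∂̄(P * φ)` the last term is killed by `τ`, as `P * φ` is supported in `K + B +
  -- B ⊆ U`.
  have h1 (φ : 𝓢(ℂ, ℂ)) (hφ : HasCompactSupport φ) (hφK : tsupport φ ⊆ K + B) :
      τ φ = τ (convSchwartz hkc φ.integrable hφ) := by
    have h2 : φ = convSchwartz hkc φ.integrable hφ + dbarSchwartz ℂ (convSchwartz hφ hPi hPc) := by
      ext x
      rw [dbarSchwartz_convSchwartz, add_apply, convSchwartz_apply, convSchwartz_apply]
      refine (hrep φ x).trans ?_
      congr 1
      rw [← integral_sub_left_eq_self _ volume x]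
      congr 1 with t
      rw [sub_sub_cancel, mul_comm]
    have h3 : τ (dbarSchwartz ℂ (convSchwartz hφ hPi hPc)) = 0 := by
      refine hτ _ (hasCompactSupport_convSchwartz _ _ _) ?_
      refine (tsupport_convSchwartz_subset _ _ _).trans (Subset.trans ?_ hKU)
      rw [add_comm]
      exact Set.add_subset_add hφK hP
    conv_lhs => rw [h2, map_add, h3, add_zero]
  obtain ⟨v, hv, hvc, hvK⟩ := exists_apply_convSchwartz_eq_integral τ (hK.add hB) hkc
  -- The regularisation is used twice, whence the two radii `δ` around `K`: `τ φ = τ (k * (k * φ)) =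
  -- ∫ v (k * φ)`, and Fubini moves the inner `k` onto `v`. The density `W = v * k'`, with `k'` the
  -- reflection of `k`, is smooth although `v` is only integrable.
  set k' : 𝓢(ℂ, ℂ) := SchwartzMap.compCLMOfContinuousLinearEquiv ℂ
    (ContinuousLinearEquiv.neg ℝ : ℂ ≃L[ℝ] ℂ) k with hk'
  have hk'a (z : ℂ) : k' z = k (-z) := rfl
  have hk'c : HasCompactSupport k' := hkc.comp_homeomorph (Homeomorph.neg ℂ)
  refine ⟨convSchwartz hk'c hv hvc, fun y hy ↦ ?_, fun φ hφ hφK ↦ ?_⟩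
  -- Testing `∂̄τ = 0` on the translate of `k` to `y` gives `∂̄W(y) = 0`, up to the sign produced by
  -- the reflection.
  · set φ : 𝓢(ℂ, ℂ) := SchwartzMap.compSubConstCLM ℂ y k with hφ
    have hφa (z : ℂ) : φ z = k (z - y) := by simp [hφ]
    have hφs : tsupport φ ⊆ K + B := by
      refine closure_minimal (fun z hz ↦ ?_) (hK.add hB).isClosed
      rw [Function.mem_support, hφa] at hz
      exact ⟨y, hy, z - y, hk (subset_closure hz), by ring⟩
    have hφc : HasCompactSupport φ := (hK.add hB).of_isClosed_subset (isClosed_tsupport _) hφs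
    have h2 : τ (dbarSchwartz ℂ φ) = 0 := hτ φ hφc (hφs.trans hKB)
    have hs := (tsupport_dbarSchwartz_subset φ).trans hφs
    rw [h1 _ (hasCompactSupport_dbarSchwartz hφc) hs, hvK _ _ hs] at h2
    rw [← dbarSchwartz_apply, dbarSchwartz_convSchwartz, convSchwartz_apply,
      ← neg_eq_zero, ← integral_neg, ← h2]
    congr 1 with t
    have h3 : (φ : ℂ → ℂ) = fun t ↦ k' (y - t) := by
      ext t; rw [hφa, hk'a, neg_sub]
    rw [dbarSchwartz_apply, dbarSchwartz_apply, h3, dbarFun_comp_const_sub k'.differentiableAt]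
    ring
  · have hΦ : tsupport (convSchwartz hkc φ.integrable hφ) ⊆ K + B :=
      (tsupport_convSchwartz_subset _ _ _).trans (Set.add_subset_add hφK hk)
    have hΦc := hasCompactSupport_convSchwartz hkc φ.integrable hφ
    rw [h1 φ hφ (hφK.trans hK1), h1 _ hΦc hΦ, hvK _ hΦc hΦ]
    simp_rw [convSchwartz_apply, hk'a, neg_sub, ← integral_const_mul]
    rw [integral_integral_swap]
    · refine integral_congr_ae (.of_forall fun t ↦ integral_congr_ae (.of_forall fun z ↦ ?_))
      simp only
      ring
    · have := (hv.mul_prod (φ.integrable (μ := volume))).mul_bdd (c := SchwartzMap.seminorm ℝ 0 0 k)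
        (g := fun p : ℂ × ℂ ↦ k (p.1 - p.2))
        (k.continuous.comp (by fun_prop)).aestronglyMeasurable
        (.of_forall fun t ↦ SchwartzMap.norm_le_seminorm ℝ k _)
      refine this.congr (.of_forall fun p ↦ ?_)
      simp only [Function.uncurry]
      ring

/-- **Weyl's lemma** for the Cauchy–Riemann operator: a tempered distribution killed by the
Cauchy–Riemann operator on an open set is given there by a holomorphic function. -/
theorem exists_holomorphic_of_dbar_eq_zero {τ : 𝓢'(ℂ, ℂ)} {U : Set ℂ} (hU : IsOpen U)
    (hτ : ∀ φ : 𝓢(ℂ, ℂ), HasCompactSupport φ → tsupport φ ⊆ U → τ (dbarSchwartz ℂ φ) = 0) :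
    ∃ u : ℂ → ℂ, DifferentiableOn ℂ u U ∧
      ∀ φ : 𝓢(ℂ, ℂ), HasCompactSupport φ → tsupport φ ⊆ U → τ φ = ∫ z, φ z * u z := by
  -- A compact exhaustion of `U` by points at distance at least `1 / (n + 1)` from the complement.
  -- The later radius `1 / (4(n + 1))` leaves room for two successive enlargements.
  set K : ℕ → Set ℂ := fun n ↦
    Metric.closedBall 0 n \ Metric.thickening (1 / ((n : ℝ) + 1)) Uᶜ with hKdef
  have hK (n : ℕ) : IsCompact (K n) :=
    (isCompact_closedBall _ _).diff Metric.isOpen_thickening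
  have hmono : Monotone K := fun m n hmn ↦ by
    refine Set.sdiff_subset_sdiff (Metric.closedBall_subset_closedBall (by exact_mod_cast hmn))
      (Metric.thickening_mono ?_ _)
    have : (m : ℝ) ≤ n := by exact_mod_cast hmn
    gcongr
  have hKU (n : ℕ) : K n ⊆ U := fun z hz ↦ by
    by_contra h
    exact hz.2 (Metric.self_subset_thickening (by positivity) _ h)
  have hcov : U ⊆ ⋃ n, interior (K n) := fun z hz ↦ by
    obtain ⟨r, hr, hrU⟩ := Metric.isOpen_iff.1 hU z hz
    obtain ⟨n, hn⟩ := exists_nat_ge (max (‖z‖ + r) (2 / r))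
    refine mem_iUnion.2 ⟨n, mem_interior.2 ⟨Metric.ball z (r / 2), fun w hw ↦ ⟨?_, fun h ↦ ?_⟩,
      Metric.isOpen_ball, Metric.mem_ball_self (by positivity)⟩⟩
    · have h1 : ‖w‖ ≤ ‖z‖ + ‖w - z‖ := by simpa using norm_add_le z (w - z)
      rw [Metric.mem_ball, dist_eq_norm] at hw
      have := (le_max_left _ _).trans hn
      rw [mem_closedBall_zero_iff]
      linarith
    · obtain ⟨y, hy, hwy⟩ := Metric.mem_thickening_iff.1 h
      refine hy (hrU ?_)
      have h2 : 1 / ((n : ℝ) + 1) ≤ r / 2 := by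
        have := (le_max_right _ _).trans hn
        rw [div_le_iff₀ hr] at this
        rw [div_le_iff₀ (by positivity)]
        nlinarith
      rw [Metric.mem_ball] at hw ⊢
      have := dist_triangle_left y z w
      linarith
  have hW (n : ℕ) := exists_eq_integral_on_compact hτ (hK n) (δ := 1 / (4 * ((n : ℝ) + 1)))
    (by positivity) (by
      rintro _ ⟨_, ⟨x, hx, y, hy, rfl⟩, y', hy', rfl⟩
      by_contra h
      refine hx.2 (Metric.mem_thickening_iff.2 ⟨x + y + y', h, ?_⟩)
      rw [mem_closedBall_zero_iff] at hy hy'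
      have h1 : dist x (x + y + y') ≤ ‖y‖ + ‖y'‖ := by
        rw [dist_comm, dist_eq_norm]
        have : x + y + y' - x = y + y' := by ring
        rw [this]
        exact norm_add_le _ _
      have h2 : 1 / (4 * ((n : ℝ) + 1)) = 1 / ((n : ℝ) + 1) / 4 := by field_simp
      have h3 : 0 < 1 / ((n : ℝ) + 1) := by positivity
      simp only [h2] at hy hy'
      linarith)
  choose W hW0 hWφ using hW
  have hmem (z : U) : ∃ n, (z : ℂ) ∈ interior (K n) := mem_iUnion.1 (hcov z.2)
  choose N hN using hmem
  classical
  set u : ℂ → ℂ := fun z ↦ if h : z ∈ U then W (N ⟨z, h⟩) z else 0 with hu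
  have huW (n : ℕ) : EqOn u (W n) (interior (K n)) := fun z hz ↦ by
    -- The local densities represent the same distribution, so they agree on overlaps and `u` does
    -- not depend on the chosen index.
    have hzU : z ∈ U := hKU n (interior_subset hz)
    simp only [hu, hzU, dif_pos]
    set m := N ⟨z, hzU⟩
    refine eqOn_of_integral_eq (O := interior (K m) ∩ interior (K n))
      (isOpen_interior.inter isOpen_interior) (W m).continuous.continuousOn
      (W n).continuous.continuousOn (fun φ hφ hφs ↦ ?_) ⟨hN ⟨z, hzU⟩, hz⟩
    rw [← hWφ m φ hφ (hφs.trans (inter_subset_left.trans interior_subset)),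
      ← hWφ n φ hφ (hφs.trans (inter_subset_right.trans interior_subset))]
  refine ⟨u, fun z hz ↦ ?_, fun φ hφ hφU ↦ ?_⟩
  · obtain ⟨n, hn⟩ := mem_iUnion.1 (hcov hz)
    have h1 : DifferentiableAt ℂ (W n) z :=
      differentiableAt_of_dbarFun_eq_zero (W n).differentiableAt (hW0 n z (interior_subset hn))
    have h2 : u =ᶠ[𝓝 z] W n := (huW n).eventuallyEq_of_mem (isOpen_interior.mem_nhds hn)
    exact (h1.congr_of_eventuallyEq h2).differentiableWithinAt
  · obtain ⟨n, hn⟩ := hφ.isCompact.elim_directed_cover (fun n ↦ interior (K n))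
      (fun _ ↦ isOpen_interior) (hφU.trans hcov)
      (Monotone.directed_le fun m n h ↦ interior_mono (hmono h))
    rw [hWφ n φ hφ (hn.trans interior_subset)]
    congr 1 with z
    by_cases hz : z ∈ tsupport φ
    · rw [huW n (hn hz)]
    · rw [image_eq_zero_of_notMem_tsupport hz, zero_mul, zero_mul]

/-- A holomorphic function which is tempered as a distribution has polynomial growth away from the
boundary. -/
lemma exists_norm_le_of_tempered {τ : 𝓢'(ℂ, ℂ)} {U : Set ℂ} {u : ℂ → ℂ}
    (hu : DifferentiableOn ℂ u U)
    (hτ : ∀ φ : 𝓢(ℂ, ℂ), HasCompactSupport φ → tsupport φ ⊆ U → τ φ = ∫ z, φ z * u z)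
    {r : ℝ} (hr : 0 < r) :
    ∃ (C : ℝ) (N : ℕ), ∀ z, Metric.ball z r ⊆ U → ‖u z‖ ≤ C * (1 + ‖z‖) ^ N := by
  obtain ⟨k, P, hk, -, -, -, hrep⟩ := exists_kernel (half_pos hr)
  obtain ⟨s, C, -, hC⟩ := Seminorm.bound_of_continuous (schwartz_withSeminorms ℂ ℂ ℂ)
    ((normSeminorm ℂ ℂ).comp τ.toLinearMap) (by exact τ.continuous.norm)
  -- The mean value formula reads `u z = τ (k(· - z))`. As `τ` is bounded by finitely many
  -- seminorms, it remains to see that the seminorms of the translates of `k` grow polynomially in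
  -- `z`.
  have hsem (i : ℕ × ℕ) : ∃ A : ℝ, 0 ≤ A ∧ ∀ z,
      schwartzSeminormFamily ℂ ℂ ℂ i (SchwartzMap.compSubConstCLM ℂ z k) ≤
        A * (1 + ‖z‖) ^ i.1 := by
    refine ⟨2 ^ i.1 * (Finset.Iic i).sup (fun m => SchwartzMap.seminorm ℂ m.1 m.2) k,
      by positivity, fun z ↦ ?_⟩
    refine SchwartzMap.seminorm_le_bound ℂ i.1 i.2 _ (by positivity) fun x ↦ ?_
    have h1 : (SchwartzMap.compSubConstCLM ℂ z k : ℂ → ℂ) = fun x ↦ k (x - z) := by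
      ext; simp
    have h2 := SchwartzMap.one_add_le_sup_seminorm_apply (𝕜 := ℂ) (m := i) le_rfl le_rfl k (x - z)
    rw [h1, iteratedFDeriv_comp_sub]
    have h3 : ‖x‖ ≤ (1 + ‖x - z‖) * (1 + ‖z‖) := by
      have : ‖x‖ ≤ ‖x - z‖ + ‖z‖ := by simpa using norm_add_le (x - z) z
      nlinarith [norm_nonneg (x - z), norm_nonneg z]
    calc ‖x‖ ^ i.1 * ‖iteratedFDeriv ℝ i.2 k (x - z)‖
        ≤ ((1 + ‖x - z‖) * (1 + ‖z‖)) ^ i.1 * ‖iteratedFDeriv ℝ i.2 k (x - z)‖ := by gcongr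
      _ = ((1 + ‖x - z‖) ^ i.1 * ‖iteratedFDeriv ℝ i.2 k (x - z)‖) * (1 + ‖z‖) ^ i.1 := by
        rw [mul_pow]; ring
      _ ≤ _ := by gcongr
  choose A hA0 hA using hsem
  refine ⟨C * ∑ i ∈ s, A i, ∑ i ∈ s, i.1, fun z hz ↦ ?_⟩
  set φ := SchwartzMap.compSubConstCLM ℂ z k with hφ
  have hφa (w : ℂ) : φ w = k (w - z) := by simp [hφ]
  have hφs : tsupport φ ⊆ Metric.closedBall z (r / 2) := by
    refine closure_minimal (fun w hw ↦ ?_) Metric.isClosed_closedBall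
    rw [Function.mem_support, hφa] at hw
    simpa [dist_eq_norm] using hk (subset_closure hw)
  have h1 : τ φ = u z := by
    rw [hrep u z r (half_lt_self hr) (hu.mono hz), hτ φ]
    · simp_rw [hφa]
    · exact (isCompact_closedBall _ _).of_isClosed_subset (isClosed_tsupport _) hφs
    · exact (hφs.trans (Metric.closedBall_subset_ball (half_lt_self hr))).trans hz
  rw [← h1]
  refine (hC φ).trans ?_
  rw [smul_apply, NNReal.smul_def, smul_eq_mul, mul_assoc]
  refine mul_le_mul_of_nonneg_left ?_ C.2
  refine (Seminorm.le_def.1 (Seminorm.finset_sup_le_sum _ s) φ).trans ?_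
  rw [sum_apply, Finset.sum_mul]
  refine Finset.sum_le_sum fun i hi ↦ (hA i z).trans ?_
  refine mul_le_mul_of_nonneg_left (pow_le_pow_right₀ (by linarith [norm_nonneg z]) ?_) (hA0 i)
  exact Finset.single_le_sum (f := fun i : ℕ × ℕ ↦ i.1) (fun _ _ ↦ Nat.zero_le _) hi

end Weyl

end

end TempMeril

namespace TempMeril

noncomputable section

open MeasureTheory Set Filter Topology Complex

/-! ### Transfer to weighted distributions on open sets. -/

section Weighted

/-- On functions supported in a fixed compact set the factor `‖x‖ ^ m` is bounded. Continuity on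
each such space is what the inductive limit topology of test functions requires. -/
lemma continuous_toSchwartz_ofSupportedIn (U : Opens ℂ) (K : Compacts ℂ) (hK : (K : Set ℂ) ⊆ U) :
    Continuous fun f : 𝓓_{K}(ℂ, ℂ) ↦ toSchwartz (TestFunction.ofSupportedIn hK f) := by
  set L : 𝓓_{K}(ℂ, ℂ) →+ 𝓢(ℂ, ℂ) :=
    { toFun f := toSchwartz (TestFunction.ofSupportedIn hK f)
      map_zero' := by ext; rfl
      map_add' f g := by ext; rfl }
  change Continuous L
  refine continuous_of_continuousAt_zero L ?_
  rw [ContinuousAt, map_zero, (schwartz_withSeminorms ℝ ℂ ℂ).tendsto_nhds]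
  rintro ⟨m, n⟩ ε hε
  obtain ⟨R, hR⟩ := K.isCompact.isBounded.exists_norm_le
  have h1 : Continuous fun f : 𝓓_{K}(ℂ, ℂ) ↦
      |R| ^ m * ContDiffMapSupportedIn.seminorm ℝ ℂ ℂ ⊤ K n f :=
    ((ContDiffMapSupportedIn.withSeminorms ℝ ℂ ℂ ⊤ K).continuous_seminorm n).const_mul _
  have h2 := h1.tendsto 0
  rw [map_zero, mul_zero] at h2
  filter_upwards [h2.eventually_lt_const hε] with f hf
  rw [sub_zero]
  refine lt_of_le_of_lt ?_ hf
  refine SchwartzMap.seminorm_le_bound ℝ m n _ (by positivity) fun x ↦ ?_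
  have h3 : ((L f : 𝓢(ℂ, ℂ)) : ℂ → ℂ) = f := rfl
  rw [h3]
  by_cases hx : x ∈ (K : Set ℂ)
  · gcongr
    · exact (hR x hx).trans (le_abs_self R)
    · exact ContDiffMapSupportedIn.norm_iteratedFDeriv_apply_le_seminorm_top ℝ
  · have : iteratedFDeriv ℝ n f x = 0 := by
      refine image_eq_zero_of_notMem_tsupport fun h ↦ hx ?_
      exact f.tsupport_subset (tsupport_iteratedFDeriv_subset n h)
    rw [this, norm_zero, mul_zero]
    positivity

/-- The inclusion of test functions into Schwartz functions, as a continuous linear map. -/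
def toSchwartzCLM (U : Opens ℂ) : 𝓓(U, ℂ) →L[ℂ] 𝓢(ℂ, ℂ) :=
  TestFunction.mkCLM ℂ toSchwartz (fun _ _ ↦ by ext; rfl) (fun _ _ ↦ by ext; rfl)
    (continuous_toSchwartz_ofSupportedIn U)

/-- The distribution `exp (-⟨z, c⟩) τ`. -/
def wDistr (c : ℂ) (τ : 𝓢'(ℂ, ℂ)) : Distr ⊤ :=
  ContinuousLinearMap.toUniformConvergenceCLM _ _ _ <|
    (⟨τ.toLinearMap, τ.continuous⟩ : 𝓢(ℂ, ℂ) →L[ℂ] ℂ) ∘L toSchwartzCLM ⊤ ∘L expTest (-c) ⊤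

lemma wDistr_apply (c : ℂ) (τ : 𝓢'(ℂ, ℂ)) (φ : 𝓓(⊤, ℂ)) :
    wDistr c τ φ = τ (toSchwartz (expTest (-c) ⊤ φ)) := rfl

lemma expPair_mul_expPair_neg (c z : ℂ) : expPair c z * expPair (-c) z = 1 := by
  rw [expPair, expPair, ← Complex.exp_add]
  simp

lemma expTest_neg_expTest (c : ℂ) (U : Opens ℂ) (φ : 𝓓(U, ℂ)) :
    expTest (-c) U (expTest c U φ) = φ := by
  ext z
  rw [expTest_apply, expTest_apply, ← mul_assoc, mul_comm (expPair (-c) z),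
    expPair_mul_expPair_neg, one_mul]

lemma expTest_expTest_neg (c : ℂ) (U : Opens ℂ) (φ : 𝓓(U, ℂ)) :
    expTest c U (expTest (-c) U φ) = φ := by
  ext z
  rw [expTest_apply, expTest_apply, ← mul_assoc, expPair_mul_expPair_neg, one_mul]

lemma expDist_wDistr (c : ℂ) (τ : 𝓢'(ℂ, ℂ)) (φ : 𝓓(⊤, ℂ)) :
    expDist c ⊤ (wDistr c τ) φ = τ (toSchwartz φ) := by
  rw [expDist_apply, wDistr_apply, expTest_neg_expTest]

lemma wDistr_mem_wTempered (c : ℂ) (τ : 𝓢'(ℂ, ℂ)) : wDistr c τ ∈ wTempered c ⊤ :=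
  ⟨τ, expDist_wDistr c τ⟩

lemma expTest_monoCLM (c : ℂ) (U : Opens ℂ) (φ : 𝓓(U, ℂ)) :
    expTest c ⊤ (TestFunction.monoCLM ℂ φ) = TestFunction.monoCLM ℂ (expTest c U φ) := by
  ext z
  rw [expTest_apply]
  simp

lemma toSchwartz_monoCLM {U : Opens ℂ} (φ : 𝓓(U, ℂ)) :
    toSchwartz (TestFunction.monoCLM ℂ φ : 𝓓(⊤, ℂ)) = toSchwartz φ := by
  ext z
  simp

lemma dbarSchwartz_toSchwartz {U : Opens ℂ} (φ : 𝓓(U, ℂ)) :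
    dbarSchwartz ℂ (toSchwartz φ) = (1 / 2 : ℂ) • (toSchwartz (TestFunction.lineDerivCLM ℂ 1 φ)
      + I • toSchwartz (TestFunction.lineDerivCLM ℂ I φ)) := by
  ext z
  rw [dbarSchwartz_apply, dbarFun]
  simp only [smul_apply, add_apply, toSchwartz_apply, lineDeriv_testFunction]
  rfl

/-- The weight is holomorphic: the terms where it is differentiated carry the factor `1 + I * I =
0`. Hence `∂̄` on weighted distributions is minus the transpose of `dbarSchwartz`. -/
lemma expDist_dbar_apply {c : ℂ} {U : Opens ℂ} {T : Distr U} {τ : 𝓢'(ℂ, ℂ)}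
    (hτ : ∀ φ, expDist c U T φ = τ (toSchwartz φ)) (φ : 𝓓(U, ℂ)) :
    expDist c U (dbar U T) φ = -τ (dbarSchwartz ℂ (toSchwartz φ)) := by
  have key (v : ℂ) : T (expTest c U (TestFunction.lineDerivCLM ℂ v φ)) =
      τ (toSchwartz (TestFunction.lineDerivCLM ℂ v φ)) := hτ _
  rw [expDist_apply, dbar_apply, lineDeriv_expTest, lineDeriv_expTest, map_add, map_add, map_smul,
    map_smul, key, key, dbarSchwartz_toSchwartz, map_smul, map_add, map_smul]
  simp only [smul_eq_mul]
  linear_combination (-1 / 2 * c * T (expTest c U φ)) * Complex.I_mul_I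

lemma expDist_injective (c : ℂ) (U : Opens ℂ) : Function.Injective (expDist c U) := by
  intro S T h
  ext φ
  have := DFunLike.congr_fun h (expTest (-c) U φ)
  simpa only [expDist_apply, expTest_expTest_neg] using this

/-- The Dolbeault operator is surjective on weighted tempered distributional forms. -/
theorem exists_dbar_eq {c : ℂ} {R : Distr ⊤} (hR : R ∈ wTempered c ⊤) :
    ∃ T ∈ wTempered c ⊤, dbar ⊤ T = R := by
  obtain ⟨ρ, hρ⟩ := hR
  obtain ⟨σ, hσ⟩ := exists_comp_dbarSchwartz_eq ρ
  -- The sign compensates the one in the definition of the derivative of a distribution.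
  refine ⟨wDistr c (-σ), wDistr_mem_wTempered c _, expDist_injective c ⊤ ?_⟩
  ext φ
  rw [expDist_dbar_apply (expDist_wDistr c _), hρ, ← hσ]
  simp

/-- A test function from a smooth function with compact support. -/
lemma exists_toSchwartz_eq {U : Opens ℂ} {φ : 𝓢(ℂ, ℂ)} (hφ : HasCompactSupport φ)
    (hφU : tsupport φ ⊆ U) : ∃ ψ : 𝓓(U, ℂ), toSchwartz ψ = φ :=
  ⟨⟨φ, φ.smooth', hφ, hφU⟩, by ext; rfl⟩

lemma restr_dbar {U : Opens ℂ} (T : Distr ⊤) : restr U (dbar ⊤ T) = dbar U (restr U T) := by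
  have h1 (φ : 𝓓(U, ℂ)) (v : ℂ) :
      (TestFunction.lineDerivCLM ℂ v (TestFunction.monoCLM ℂ φ : 𝓓(⊤, ℂ)) : 𝓓(⊤, ℂ)) =
        TestFunction.monoCLM ℂ (TestFunction.lineDerivCLM ℂ v φ : 𝓓(U, ℂ)) := by
    ext z
    rw [lineDeriv_testFunction]
    simp [lineDeriv_testFunction, -TestFunction.lineDerivCLM_apply]
  ext φ
  rw [restr_apply, dbar_apply, dbar_apply, h1, h1, restr_apply, restr_apply]

lemma restr_mem_wTempered {c : ℂ} {U : Opens ℂ} {T : Distr ⊤} (hT : T ∈ wTempered c ⊤) :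
    restr U T ∈ wTempered c U := by
  obtain ⟨τ, hτ⟩ := hT
  refine ⟨τ, fun φ ↦ ?_⟩
  have := hτ (TestFunction.monoCLM ℂ φ)
  rwa [expDist_apply, expTest_monoCLM, toSchwartz_monoCLM] at this

/-- The holomorphic form with a given coefficient on an open set. -/
def Holo.mk {U : Opens ℂ} {u : ℂ → ℂ} (hu : DifferentiableOn ℂ u U) : Holo U :=
  ⟨(U : Set ℂ).indicator u, hu.congr fun _ hz ↦ indicator_of_mem hz _,
    fun _ hz ↦ indicator_of_notMem hz _⟩

lemma Holo.coeff_mk {U : Opens ℂ} {u : ℂ → ℂ} (hu : DifferentiableOn ℂ u U) {z : ℂ} (hz : z ∈ U) :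
    coeff (Holo.mk hu) z = u z := indicator_of_mem (s := (U : Set ℂ)) hz u

lemma Holo.ext {U : Opens ℂ} {u v : Holo U} (h : ∀ z ∈ U, coeff u z = coeff v z) : u = v := by
  apply coeff_injective
  ext z
  by_cases hz : z ∈ U
  · exact h z hz
  · rw [coeff_eq_zero u hz, coeff_eq_zero v hz]

/-- Weighted tempered distributional forms killed by the Dolbeault operator are holomorphic. -/
theorem exists_restr_eq_holoDistr {c : ℂ} {U : Opens ℂ} {T : Distr ⊤} (hT : T ∈ wTempered c ⊤)
    (h : restr U (dbar ⊤ T) = 0) : ∃ ω ∈ wOmega c U, restr U T = holoDistr U ω := by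
  obtain ⟨τ, hτ⟩ := id hT
  obtain ⟨u, hu, huτ⟩ := exists_holomorphic_of_dbar_eq_zero (τ := τ) U.isOpen fun φ hφ hφU ↦ by
    obtain ⟨ψ, rfl⟩ := exists_toSchwartz_eq hφ hφU
    have h1 := expDist_dbar_apply hτ (TestFunction.monoCLM ℂ ψ)
    have h2 := DFunLike.congr_fun h (expTest c U ψ)
    rw [toSchwartz_monoCLM, expDist_apply, expTest_monoCLM, ← restr_apply, h2] at h1
    simpa using h1
  have hexp : Differentiable ℂ (expPair (-c)) := by unfold expPair; fun_prop
  have hω : DifferentiableOn ℂ (fun z ↦ expPair (-c) z * u z) U := hexp.differentiableOn.mul hu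
  have h3 : restr U T = holoDistr U (Holo.mk hω) := by
    ext φ
    have h4 : restr U T φ = τ (toSchwartz (expTest (-c) U φ)) := by
      have := hτ (TestFunction.monoCLM ℂ (expTest (-c) U φ))
      rw [expDist_apply, expTest_monoCLM, expTest_expTest_neg, toSchwartz_monoCLM] at this
      rw [restr_apply, this]
    have h5 := huτ (toSchwartz (expTest (-c) U φ)) (expTest (-c) U φ).hasCompactSupport
      (expTest (-c) U φ).tsupport_subset
    rw [h4, h5, holoDistr_apply]
    congr 1 with z
    rw [toSchwartz_apply, expTest_apply]
    by_cases hz : z ∈ tsupport φ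
    · rw [Holo.coeff_mk hω (φ.tsupport_subset hz)]
      ring
    · rw [image_eq_zero_of_notMem_tsupport hz]
      ring
  exact ⟨Holo.mk hω, by rw [wOmega, Submodule.mem_comap, ← h3]; exact restr_mem_wTempered hT, h3⟩

/-- Existence of weighted tempered extensions. -/
lemma exists_restr_eq {c : ℂ} {U : Opens ℂ} {T : Distr U} (hT : T ∈ wTempered c U) :
    ∃ T' ∈ wTempered c ⊤, restr U T' = T := by
  obtain ⟨τ, hτ⟩ := hT
  refine ⟨wDistr c τ, wDistr_mem_wTempered c τ, ?_⟩
  ext φ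
  rw [restr_apply, wDistr_apply, expTest_monoCLM, toSchwartz_monoCLM, ← hτ, expDist_apply,
    expTest_expTest_neg]

lemma integral_dbarSchwartz (h : 𝓢(ℂ, ℂ)) : ∫ z, dbarSchwartz ℂ h z = 0 := by
  have h1 (v : ℂ) : ∫ z, (LineDeriv.lineDerivOp v h : 𝓢(ℂ, ℂ)) z = 0 := by
    have h2 : (LineDeriv.lineDerivOp v h : ℂ → ℂ) = fun z ↦ fderiv ℝ h z v := by
      ext z; rw [SchwartzMap.lineDerivOp_apply_eq_fderiv]
    have h3 : Integrable fun z ↦ fderiv ℝ h z v := h2 ▸ SchwartzMap.integrable _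
    have := integral_mul_fderiv_eq_neg_fderiv_mul_of_integrable (μ := volume) (𝕜 := ℂ)
      (f := fun _ ↦ (1 : ℂ)) (g := h) (v := v) (by simp) (by simpa using h3)
      (by simpa using h.integrable) (fun _ _ ↦ by fun_prop) (fun _ _ ↦ h.differentiableAt)
    rw [h2]
    simpa using this
  have h4 (v : ℂ) : Integrable (LineDeriv.lineDerivOp v h : 𝓢(ℂ, ℂ)) := SchwartzMap.integrable _
  simp only [dbarSchwartz, FunLike.coe_smul, FunLike.coe_add, Pi.smul_apply, Pi.add_apply,
    LineDeriv.lineDerivOpCLM_apply, smul_eq_mul]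
  rw [integral_const_mul, integral_add (h4 1) ((h4 I).const_mul I), integral_const_mul, h1, h1]
  simp

/-- The product `ωφ`, extended by zero, is smooth with compact support, and `∂̄(ωφ) = ω ∂̄φ`. The
integral of a `∂̄`-derivative of a Schwartz function vanishes. -/
lemma dbar_holoDistr {U : Opens ℂ} (ω : Holo U) : dbar U (holoDistr U ω) = 0 := by
  ext φ
  have hω (z : ℂ) (hz : z ∈ tsupport φ) : DifferentiableAt ℂ (coeff ω) z :=
    (differentiableOn_coeff ω).differentiableAt (U.isOpen.mem_nhds (φ.tsupport_subset hz))
  have h0 (z : ℂ) (hz : z ∉ tsupport φ) : (fun w ↦ coeff ω w * φ w) =ᶠ[𝓝 z] fun _ ↦ 0 := by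
    filter_upwards [(isClosed_tsupport φ).isOpen_compl.mem_nhds hz] with w hw
    rw [image_eq_zero_of_notMem_tsupport hw, mul_zero]
  have hd : ContDiff ℝ (⊤ : ℕ∞) fun z ↦ coeff ω z * φ z := by
    rw [contDiff_iff_contDiffAt]
    intro z
    by_cases hz : z ∈ tsupport φ
    · have h1 : ContDiffAt ℂ (⊤ : ℕ∞) (coeff ω) z :=
        ((differentiableOn_coeff ω).contDiffOn U.isOpen).contDiffAt
          (U.isOpen.mem_nhds (φ.tsupport_subset hz))
      exact (h1.restrict_scalars ℝ).mul φ.contDiff.contDiffAt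
    · exact contDiffAt_const.congr_of_eventuallyEq (h0 z hz)
  have h1 := integral_dbarSchwartz
    ((φ.hasCompactSupport.mul_left (f := coeff ω)).toSchwartzMap hd)
  have h2 (z : ℂ) : dbarFun (fun z ↦ coeff ω z * φ z) z =
      1 / 2 * ((TestFunction.lineDerivCLM ℂ 1 φ : 𝓓(U, ℂ)) z * coeff ω z +
        I * ((TestFunction.lineDerivCLM ℂ I φ : 𝓓(U, ℂ)) z * coeff ω z)) := by
    rw [lineDeriv_testFunction, lineDeriv_testFunction]
    by_cases hz : z ∈ tsupport φ
    · rw [dbarFun_mul_of_differentiableAt (hω z hz)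
        ((φ.contDiff.differentiable (by simp)).differentiableAt), dbarFun]
      simp only [smul_eq_mul]
      ring
    · have h3 : fderiv ℝ φ z = 0 :=
        image_eq_zero_of_notMem_tsupport fun h ↦ hz (tsupport_fderiv_subset ℝ h)
      rw [dbarFun, (h0 z hz).fderiv_eq, h3]
      simp
  have h3 : ∫ z, dbarFun (fun z ↦ coeff ω z * φ z) z = 0 := by
    rw [← h1]
    congr 1
  have h4 (v : ℂ) : Integrable fun z ↦
      (TestFunction.lineDerivCLM ℂ v φ : 𝓓(U, ℂ)) z * coeff ω z :=
    TestFunction.integrable_bilin (ContinuousLinearMap.mul ℂ ℂ) (locallyIntegrableOn_coeff ω) _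
  simp_rw [h2] at h3
  rw [integral_const_mul, integral_add (h4 1) ((h4 I).const_mul I), integral_const_mul] at h3
  rw [dbar_apply, holoDistr_apply, holoDistr_apply]
  refine Eq.trans ?_ (neg_eq_zero.2 h3)
  ring

lemma holoDistr_injective (U : Opens ℂ) : Function.Injective (holoDistr U) := by
  intro u v h
  refine Holo.ext fun z hz ↦ ?_
  refine eqOn_of_integral_eq U.isOpen (differentiableOn_coeff u).continuousOn
    (differentiableOn_coeff v).continuousOn (fun φ hφ hφU ↦ ?_) hz
  obtain ⟨ψ, rfl⟩ := exists_toSchwartz_eq hφ hφU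
  have := DFunLike.congr_fun h ψ
  rwa [holoDistr_apply, holoDistr_apply] at this

end Weighted

end

end TempMeril

namespace TempMeril

noncomputable section

open MeasureTheory Set Filter Topology Complex

/-- The first isomorphism theorem for a surjective linear map with a given kernel. -/
def quotEquivOfKerEq {R M N : Type*} [Ring R] [AddCommGroup M] [Module R M] [AddCommGroup N]
    [Module R N] {p : Submodule R M} (f : M →ₗ[R] N) (hp : LinearMap.ker f = p)
    (hf : Function.Surjective f) : (M ⧸ p) ≃ₗ[R] N :=
  (Submodule.quotEquivOfEq _ _ hp.symm).trans (f.quotKerEquivOfSurjective hf)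

/-- The first isomorphism theorem for a surjective linear map onto a submodule. -/
def quotEquivSubmodule {R M N : Type*} [Ring R] [AddCommGroup M] [Module R M] [AddCommGroup N]
    [Module R N] {p : Submodule R M} {q : Submodule R N} (f : M →ₗ[R] q)
    (hp : LinearMap.ker f = p) (hf : Function.Surjective f) : (M ⧸ p) ≃ₗ[R] q :=
  quotEquivOfKerEq f hp hf

lemma quotEquivSubmodule_mk {R M N : Type*} [Ring R] [AddCommGroup M] [Module R M]
    [AddCommGroup N] [Module R N] {p : Submodule R M} {q : Submodule R N} (f : M →ₗ[R] q)
    (hp : LinearMap.ker f = p) (hf : Function.Surjective f) (x : M) :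
    quotEquivSubmodule f hp hf (Submodule.Quotient.mk x) = f x := rfl

/-! ### The isomorphism for a fixed closed support. -/

section Dolbeault

variable {c : ℂ} {Z : Closeds ℂ}

lemma dbar_mem_secSupp_of_restr_eq {T : Distr ⊤} (hT : T ∈ wTempered c ⊤) {ω : Holo Z.compl}
    (h : restr Z.compl T = holoDistr Z.compl ω) : dbar ⊤ T ∈ secSupp c Z :=
  ⟨dbar_mem_wTempered hT, LinearMap.mem_ker.2 (by rw [restr_dbar, h, dbar_holoDistr])⟩

lemma mem_secSupp_sub {T T' : Distr ⊤} (hT : T ∈ wTempered c ⊤) (hT' : T' ∈ wTempered c ⊤)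
    (h : restr Z.compl T = restr Z.compl T') : T - T' ∈ secSupp c Z :=
  ⟨sub_mem hT hT', LinearMap.mem_ker.2 (by rw [map_sub, h, sub_self])⟩

/-- The difference `T - T'` is itself supported in `Z`, so its image by `∂̄` is a coboundary. This
gives independence of the extension. -/
lemma mk_eq_mk_of_restr_eq {T T' : Distr ⊤} (hT : T ∈ wTempered c ⊤) (hT' : T' ∈ wTempered c ⊤)
    (h : restr Z.compl T = restr Z.compl T') {R R' : secSupp c Z} (hR : (R : Distr ⊤) = dbar ⊤ T)
    (hR' : (R' : Distr ⊤) = dbar ⊤ T') :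
    (Submodule.Quotient.mk R : H1 c Z) = Submodule.Quotient.mk R' := by
  rw [Submodule.Quotient.eq]
  refine ⟨⟨T - T', mem_secSupp_sub hT hT' h⟩, Subtype.ext ?_⟩
  change dbar ⊤ (T - T') = R - R'
  rw [map_sub, hR, hR']

lemma exists_extension (ω : wOmega c Z.compl) :
    ∃ T ∈ wTempered c ⊤, restr Z.compl T = holoDistr Z.compl ω :=
  exists_restr_eq ω.2

/-- The class of `∂̄ T`, for `T` a weighted tempered extension of a holomorphic form. -/
def dbarClass (c : ℂ) (Z : Closeds ℂ) (ω : wOmega c Z.compl) : H1 c Z :=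
  Submodule.Quotient.mk ⟨dbar ⊤ (exists_extension ω).choose,
    dbar_mem_secSupp_of_restr_eq (exists_extension ω).choose_spec.1
      (exists_extension ω).choose_spec.2⟩

lemma dbarClass_eq {ω : wOmega c Z.compl} {T : Distr ⊤} (hT : T ∈ wTempered c ⊤)
    (h : restr Z.compl T = holoDistr Z.compl ω) {R : secSupp c Z}
    (hR : (R : Distr ⊤) = dbar ⊤ T) : dbarClass c Z ω = Submodule.Quotient.mk R :=
  mk_eq_mk_of_restr_eq (exists_extension ω).choose_spec.1 hT
    ((exists_extension ω).choose_spec.2.trans h.symm) rfl hR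

lemma exists_dbarClass_eq {ω : wOmega c Z.compl} {T : Distr ⊤} (hT : T ∈ wTempered c ⊤)
    (h : restr Z.compl T = holoDistr Z.compl ω) :
    ∃ R : secSupp c Z, (R : Distr ⊤) = dbar ⊤ T ∧ dbarClass c Z ω = Submodule.Quotient.mk R :=
  ⟨⟨dbar ⊤ T, dbar_mem_secSupp_of_restr_eq hT h⟩, rfl, dbarClass_eq hT h rfl⟩

/-- The class of `∂̄ T`, as a linear map. -/
def dbarClassLin (c : ℂ) (Z : Closeds ℂ) : wOmega c Z.compl →ₗ[ℂ] H1 c Z where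
  toFun := dbarClass c Z
  map_add' ω ω' := by
    obtain ⟨T, hT, h⟩ := exists_extension ω
    obtain ⟨T', hT', h'⟩ := exists_extension ω'
    obtain ⟨R, hR, e⟩ := exists_dbarClass_eq hT h
    obtain ⟨R', hR', e'⟩ := exists_dbarClass_eq hT' h'
    rw [e, e', dbarClass_eq (T := T + T') (R := R + R') (add_mem hT hT')
      (by rw [map_add, h, h']; exact (map_add _ _ _).symm)
      (by rw [map_add, ← hR, ← hR']; rfl)]
    rfl
  map_smul' a ω := by
    obtain ⟨T, hT, h⟩ := exists_extension ω
    obtain ⟨R, hR, e⟩ := exists_dbarClass_eq hT h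
    rw [e, dbarClass_eq (T := a • T) (R := a • R) (Submodule.smul_mem _ a hT)
      (by rw [map_smul, h]; exact (map_smul _ _ _).symm) (by rw [map_smul, ← hR]; rfl)]
    rfl

lemma restr_holoDistr {U : Opens ℂ} (u : Holo ⊤) :
    restr U (holoDistr ⊤ u) = holoDistr U (holoRestr le_top u) := by
  ext φ
  rw [restr_apply, holoDistr_apply, holoDistr_apply]
  congr 1 with z
  by_cases hz : z ∈ U
  · simp [coeff_holoRestr, hz]
  · have h3 : φ z = 0 := image_eq_zero_of_notMem_tsupport fun h' ↦ hz (φ.tsupport_subset h')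
    simp [h3]

lemma restr_top (T : Distr ⊤) : restr ⊤ T = T := by
  ext φ
  rw [restr_apply]
  congr 1
  ext z
  simp

/-- If `∂̄T = ∂̄Q` with `Q` supported in `Z`, then `T - Q` is `∂̄`-closed on the line, hence entire
by Weyl's lemma, and restricts to `ω`. Conversely an entire form is its own extension, with zero
`∂̄`. -/
lemma ker_dbarClassLin (c : ℂ) (Z : Closeds ℂ) :
    LinearMap.ker (dbarClassLin c Z) =
      LinearMap.range (wOmegaRestr c (le_top : Z.compl ≤ ⊤)) := by
  ext ω
  constructor
  · intro hω
    obtain ⟨T, hT, h⟩ := exists_extension ω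
    obtain ⟨R, hR, e⟩ := exists_dbarClass_eq hT h
    have h0 : (Submodule.Quotient.mk R : H1 c Z) = 0 := e.symm.trans hω
    rw [Submodule.Quotient.mk_eq_zero] at h0
    obtain ⟨Q, rfl⟩ := h0
    have h1 : dbar ⊤ (T - Q) = 0 := by
      rw [map_sub, ← hR]
      exact sub_self _
    obtain ⟨u, hu, hTu⟩ := exists_restr_eq_holoDistr (U := ⊤) (sub_mem hT Q.2.1)
      (by rw [h1, map_zero])
    rw [restr_top] at hTu
    refine ⟨⟨u, hu⟩, Subtype.ext (holoDistr_injective _ ?_)⟩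
    change holoDistr _ (holoRestr le_top u) = _
    rw [← restr_holoDistr, ← hTu, map_sub, LinearMap.mem_ker.1 Q.2.2, sub_zero, h]
  · rintro ⟨u, rfl⟩
    refine (dbarClass_eq (T := holoDistr ⊤ u) (R := 0) u.2 (restr_holoDistr _) ?_).trans ?_
    · rw [dbar_holoDistr]; rfl
    · rfl

/-- A global solution `T` of `∂̄T = R` is holomorphic off `Z`, where `R` vanishes. -/
lemma dbarClassLin_surjective (c : ℂ) (Z : Closeds ℂ) :
    Function.Surjective (dbarClassLin c Z) := by
  intro x
  obtain ⟨R, rfl⟩ := Submodule.Quotient.mk_surjective _ x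
  obtain ⟨T, hT, hTR⟩ := exists_dbar_eq R.2.1
  obtain ⟨ω, hω, h⟩ := exists_restr_eq_holoDistr (U := Z.compl) hT
    (by rw [hTR]; exact LinearMap.mem_ker.1 R.2.2)
  exact ⟨⟨ω, hω⟩, dbarClass_eq hT h hTR.symm⟩

/-- The isomorphism `[ω] ↦ [∂̄ T]`, with `T` a weighted tempered extension of `ω`. -/
def dbarEquiv (c : ℂ) (Z : Closeds ℂ) : OmegaQuot c Z ≃ₗ[ℂ] H1 c Z :=
  quotEquivOfKerEq (dbarClassLin c Z) (ker_dbarClassLin c Z) (dbarClassLin_surjective c Z)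

lemma dbarEquiv_mk (ω : wOmega c Z.compl) :
    dbarEquiv c Z (Submodule.Quotient.mk ω) = dbarClass c Z ω := rfl

/-- One extension `T` serves both supports. -/
lemma H1map_dbarClass {Z' : Closeds ℂ} (h : Z ≤ Z') (h' : Z'.compl ≤ Z.compl)
    (ω : wOmega c Z.compl) :
    H1map c h (dbarClass c Z ω) = dbarClass c Z' (wOmegaRestr c h' ω) := by
  obtain ⟨T, hT, e⟩ := exists_extension ω
  obtain ⟨R, hR, e'⟩ := exists_dbarClass_eq hT e
  rw [e', dbarClass_eq (T := T) (R := Submodule.inclusion (secSupp_mono c h) R) hT ?_ hR]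
  · rfl
  · ext φ
    have h1 := DFunLike.congr_fun e (TestFunction.monoCLM ℂ φ : 𝓓(Z.compl, ℂ))
    rw [restr_apply, holoDistr_apply] at h1
    rw [restr_apply, holoDistr_apply]
    have h2 : (TestFunction.monoCLM ℂ (TestFunction.monoCLM ℂ φ : 𝓓(Z.compl, ℂ)) : 𝓓(⊤, ℂ)) =
        TestFunction.monoCLM ℂ φ := by
      ext z
      simp [h']
    rw [h2] at h1
    rw [h1]
    congr 1 with z
    by_cases hz : z ∈ Z'.compl
    · have : coeff (wOmegaRestr c h' ω : Holo Z'.compl) z = coeff (ω : Holo Z.compl) z :=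
        indicator_of_mem (s := (Z'.compl : Set ℂ)) hz _
      rw [this]
      simp [h']
    · have h3 : φ z = 0 := image_eq_zero_of_notMem_tsupport fun h'' ↦ hz (φ.tsupport_subset h'')
      simp [h3, h']

end Dolbeault

end

end TempMeril

namespace TempMeril

noncomputable section

open MeasureTheory Set Filter Topology Complex

/-! ### The projective limit over shrinking thickenings. -/

section Limit

variable {c : ℂ} {S : Closeds ℂ}

lemma exists_notMem_thick {z : ℂ} (hz : z ∉ S) : ∃ ε : Ioi (0 : ℝ), z ∉ thick S ε := by
  have h1 : z ∉ ⋂ δ > 0, Metric.cthickening δ (S : Set ℂ) := by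
    rw [← Metric.closure_eq_iInter_cthickening, S.isClosed.closure_eq]
    exact hz
  simp only [mem_iInter, not_forall] at h1
  obtain ⟨δ, hδ, h⟩ := h1
  exact ⟨⟨δ, hδ⟩, h⟩

lemma thick_le_thick {ε η : Ioi (0 : ℝ)} (h : ε ≤ η) : thick S ε ≤ thick S η :=
  thick_mono S h

lemma compl_thick_mono {ε η : Ioi (0 : ℝ)} (h : ε ≤ η) : (thick S η).compl ≤ (thick S ε).compl :=
  compl_subset_compl.2 (thick_mono S h)

lemma coeff_holoRestr_of_mem {U W : Opens ℂ} (h : W ≤ U) (u : Holo U) {z : ℂ} (hz : z ∈ W) :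
    coeff (holoRestr h u) z = coeff u z :=
  indicator_of_mem (s := (W : Set ℂ)) hz _

lemma coeff_wOmegaRestr_of_mem {U W : Opens ℂ} (h : W ≤ U) (u : wOmega c U) {z : ℂ}
    (hz : z ∈ W) : coeff (wOmegaRestr c h u : Holo W) z = coeff (u : Holo U) z :=
  coeff_holoRestr_of_mem h _ hz

lemma coeff_infToThick_of_mem (ε : Ioi (0 : ℝ)) (ω : wOmegaInf c S) {z : ℂ}
    (hz : z ∈ (thick S ε).compl) :
    coeff (infToThick c S ε ω : Holo (thick S ε).compl) z = coeff (ω : Holo S.compl) z :=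
  coeff_holoRestr_of_mem (compl_thick_le S ε) _ hz

/-- The identity theorem for entire forms. -/
lemma Holo.eq_of_eqOn {u v : Holo ⊤} {W : Opens ℂ} (hW : (W : Set ℂ).Nonempty)
    (h : ∀ z ∈ W, coeff u z = coeff v z) : u = v := by
  have key (w : Holo ⊤) : AnalyticOnNhd ℂ (coeff w) univ :=
    (differentiableOn_coeff w).analyticOnNhd isOpen_univ
  obtain ⟨z₀, hz₀⟩ := hW
  refine coeff_injective ((key u).eq_of_eventuallyEq (key v) (z₀ := z₀) ?_)
  filter_upwards [W.isOpen.mem_nhds hz₀] with z hz using h z hz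

lemma wOmegaRestr_infToThick {ε η : Ioi (0 : ℝ)} (h : ε ≤ η) (ω : wOmegaInf c S) :
    wOmegaRestr c (compl_thick_mono h) (infToThick c S ε ω) = infToThick c S η ω := by
  refine Subtype.ext (Holo.ext fun z hz ↦ ?_)
  have hle := compl_thick_mono (S := S) h
  rw [coeff_wOmegaRestr_of_mem hle _ hz, coeff_infToThick_of_mem _ _ hz,
    coeff_infToThick_of_mem _ _ (hle hz)]

/-- The classes `[∂̄ T_ε]`, with `T_ε` a weighted tempered extension of `ω` restricted to the
complement of `S_ε`. -/
def limClassLin (c : ℂ) (S : Closeds ℂ) : wOmegaInf c S →ₗ[ℂ] limH1 c S :=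
  LinearMap.codRestrict _
    (LinearMap.pi fun ε : Ioi (0 : ℝ) ↦ dbarClassLin c (thick S ε) ∘ₗ infToThick c S ε)
    fun ω ε η h ↦ by
      change H1map c _ (dbarClass c _ (infToThick c S ε ω)) = dbarClass c _ (infToThick c S η ω)
      rw [H1map_dbarClass (thick_le_thick h) (compl_thick_mono h), wOmegaRestr_infToThick h]

lemma limClassLin_apply (ω : wOmegaInf c S) (ε : Ioi (0 : ℝ)) :
    (limClassLin c S ω).1 ε = dbarClass c (thick S ε) (infToThick c S ε ω) := rfl

/-- A weighted tempered form with trivial class extends to an entire form. -/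
lemma exists_entire_of_dbarClass_eq_zero {Z : Closeds ℂ} {ω : wOmega c Z.compl}
    (h : dbarClass c Z ω = 0) :
    ∃ u : wOmega c ⊤, ∀ z ∈ Z.compl, coeff (ω : Holo Z.compl) z = coeff (u : Holo ⊤) z := by
  have h1 : ω ∈ LinearMap.ker (dbarClassLin c Z) := LinearMap.mem_ker.2 h
  rw [ker_dbarClassLin] at h1
  obtain ⟨u, rfl⟩ := h1
  exact ⟨u, fun z hz ↦ coeff_wOmegaRestr_of_mem _ _ hz⟩

lemma dbarClass_wOmegaRestr (Z : Closeds ℂ) (u : wOmega c ⊤) :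
    dbarClass c Z (wOmegaRestr c le_top u) = 0 := by
  have h : wOmegaRestr c le_top u ∈ LinearMap.ker (dbarClassLin c Z) := by
    rw [ker_dbarClassLin]
    exact ⟨u, rfl⟩
  exact LinearMap.mem_ker.1 h

lemma ker_limClassLin (hS : ∀ ε : Ioi (0 : ℝ), ((thick S ε).compl : Set ℂ).Nonempty) :
    LinearMap.ker (limClassLin c S) = LinearMap.range (wOmegaToInf c S) := by
  ext ω
  constructor
  · intro hω
    have h1 (ε : Ioi (0 : ℝ)) : ∃ u : wOmega c ⊤, ∀ z ∈ (thick S ε).compl,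
        coeff (ω : Holo S.compl) z = coeff (u : Holo ⊤) z := by
      have h2 : dbarClass c (thick S ε) (infToThick c S ε ω) = 0 := by
        rw [← limClassLin_apply, LinearMap.mem_ker.1 hω]
        rfl
      obtain ⟨u, hu⟩ := exists_entire_of_dbarClass_eq_zero h2
      exact ⟨u, fun z hz ↦ by rw [← hu z hz, coeff_infToThick_of_mem _ _ hz]⟩
    choose u hu using h1
    -- Both entire forms equal `ω` off the larger thickening, whose complement is a nonempty open
    -- set.
    have h3 (ε η : Ioi (0 : ℝ)) : (u ε : Holo ⊤) = u η :=
      Holo.eq_of_eqOn (hS (max ε η)) fun z hz ↦ by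
        rw [← hu ε z (compl_thick_mono (le_max_left ε η) hz),
          ← hu η z (compl_thick_mono (le_max_right ε η) hz)]
    refine ⟨u ⟨1, mem_Ioi.2 one_pos⟩, Subtype.ext (Holo.ext fun z hz ↦ ?_)⟩
    obtain ⟨ε, hε⟩ := exists_notMem_thick (S := S) hz
    rw [hu ε z hε, h3 ε ⟨1, mem_Ioi.2 one_pos⟩]
    exact coeff_holoRestr_of_mem le_top _ hz
  · rintro ⟨u, rfl⟩
    refine LinearMap.mem_ker.2 (Subtype.ext (funext fun ε ↦ ?_))
    rw [limClassLin_apply]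
    refine Eq.trans ?_ (dbarClass_wOmegaRestr (thick S ε) u)
    congr 1
    refine Subtype.ext (Holo.ext fun z hz ↦ ?_)
    rw [coeff_infToThick_of_mem _ _ hz, coeff_wOmegaRestr_of_mem _ _ hz]
    exact coeff_holoRestr_of_mem le_top _ (compl_thick_le S ε hz)

lemma dbarClass_sub {Z : Closeds ℂ} (ω ω' : wOmega c Z.compl) :
    dbarClass c Z (ω - ω') = dbarClass c Z ω - dbarClass c Z ω' :=
  map_sub (dbarClassLin c Z) ω ω'

lemma coeff_coe_sub {U : Opens ℂ} (ω ω' : wOmega c U) (z : ℂ) :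
    coeff ((ω - ω' : wOmega c U) : Holo U) z = coeff (ω : Holo U) z - coeff (ω' : Holo U) z := rfl

/-- Representatives of a compatible family of classes differ by entire forms. -/
lemma exists_entire_sub {x : limH1 c S} {ω : ∀ ε : Ioi (0 : ℝ), wOmega c (thick S ε).compl}
    (hω : ∀ ε : Ioi (0 : ℝ), dbarClass c (thick S ε) (ω ε) = x.1 ε) {ε η δ : Ioi (0 : ℝ)} (hε : ε ≤ δ)
    (hη : η ≤ δ) : ∃ u : wOmega c ⊤, ∀ z ∈ (thick S δ).compl,
      coeff (ω ε : Holo (thick S ε).compl) z - coeff (ω η : Holo (thick S η).compl) z =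
        coeff (u : Holo ⊤) z := by
  have h1 (ε : Ioi (0 : ℝ)) (h : ε ≤ δ) :
      dbarClass c (thick S δ) (wOmegaRestr c (compl_thick_mono h) (ω ε)) = x.1 δ := by
    rw [← H1map_dbarClass (thick_le_thick h), hω, x.2 ε δ h]
  obtain ⟨u, hu⟩ := exists_entire_of_dbarClass_eq_zero
    (ω := wOmegaRestr c (compl_thick_mono hε) (ω ε) - wOmegaRestr c (compl_thick_mono hη) (ω η))
    (by rw [dbarClass_sub, h1 ε hε, h1 η hη, sub_self])
  have hε' := compl_thick_mono (S := S) hε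
  have hη' := compl_thick_mono (S := S) hη
  refine ⟨u, fun z hz ↦ ?_⟩
  rw [← hu z hz, coeff_coe_sub, coeff_wOmegaRestr_of_mem hε' _ hz, coeff_wOmegaRestr_of_mem hη' _ hz]

/-- Gluing of compatible forms on the complements of the thickenings. -/
lemma exists_infToThick_eq {ω : ∀ ε : Ioi (0 : ℝ), wOmega c (thick S ε).compl}
    (h : ∀ ε η : Ioi (0 : ℝ), ε ≤ η → ∀ z ∈ (thick S η).compl,
      coeff (ω ε : Holo (thick S ε).compl) z = coeff (ω η : Holo (thick S η).compl) z) :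
    ∃ ω' : wOmegaInf c S, ∀ ε, infToThick c S ε ω' = ω ε := by
  have h1 (z : ℂ) : ∃ ε : Ioi (0 : ℝ), z ∉ S → z ∉ thick S ε := by
    by_cases hz : z ∈ S
    · exact ⟨⟨1, mem_Ioi.2 one_pos⟩, fun h ↦ (h hz).elim⟩
    · obtain ⟨ε, hε⟩ := exists_notMem_thick hz
      exact ⟨ε, fun _ ↦ hε⟩
  choose e he using h1
  have h2 (ε : Ioi (0 : ℝ)) (z : ℂ) (hz : z ∈ (thick S ε).compl) :
      coeff (ω (e z) : Holo (thick S (e z)).compl) z =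
        coeff (ω ε : Holo (thick S ε).compl) z := by
    have hz' : z ∈ (thick S (e z)).compl := he z (compl_thick_le S ε hz)
    rcases le_total ε (e z) with h3 | h3
    · exact (h _ _ h3 z hz').symm
    · exact h _ _ h3 z hz
  have h3 : DifferentiableOn ℂ
      (fun z ↦ coeff (ω (e z) : Holo (thick S (e z)).compl) z) S.compl := by
    intro z hz
    obtain ⟨ε, hε⟩ := exists_notMem_thick (S := S) hz
    have h4 : (thick S ε).compl.1 ∈ 𝓝 z := (thick S ε).compl.isOpen.mem_nhds hε
    have h5 := (differentiableOn_coeff (ω ε : Holo (thick S ε).compl)).differentiableAt h4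
    refine (h5.congr_of_eventuallyEq ?_).differentiableWithinAt
    filter_upwards [h4] with w hw using h2 ε w hw
  have h4 (ε : Ioi (0 : ℝ)) : holoRestr (compl_thick_le S ε) (Holo.mk h3) = ω ε := by
    refine Holo.ext fun z hz ↦ ?_
    rw [coeff_holoRestr_of_mem _ _ hz, Holo.coeff_mk h3 (compl_thick_le S ε hz), h2 ε z hz]
  refine ⟨⟨Holo.mk h3, (Submodule.mem_iInf _).2 fun ε ↦ ?_⟩, fun ε ↦ Subtype.ext (h4 ε)⟩
  rw [Submodule.mem_comap, h4]
  exact (ω ε).2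

lemma limClassLin_surjective (hS : ∀ ε : Ioi (0 : ℝ), ((thick S ε).compl : Set ℂ).Nonempty) :
    Function.Surjective (limClassLin c S) := by
  intro x
  choose ω hω using fun ε : Ioi (0 : ℝ) ↦ dbarClassLin_surjective c (thick S ε) (x.1 ε)
  -- Reference index: `u ε` is the entire form equal to `ω ε - ω e` off the larger of the two
  -- thickenings. Subtracting it keeps the class and makes every representative agree with `ω e`
  -- there.
  set e : Ioi (0 : ℝ) := ⟨1, mem_Ioi.2 one_pos⟩
  choose u hu using fun ε : Ioi (0 : ℝ) ↦
    exists_entire_sub hω (le_max_left ε e) (le_max_right ε e)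
  have h1 (ε : Ioi (0 : ℝ)) :
      dbarClass c (thick S ε) (ω ε - wOmegaRestr c le_top (u ε)) = x.1 ε := by
    rw [dbarClass_sub, dbarClass_wOmegaRestr, sub_zero]
    exact hω ε
  have h2 (ε : Ioi (0 : ℝ)) (z : ℂ) (hz : z ∈ (thick S ε).compl) :
      coeff ((ω ε - wOmegaRestr c le_top (u ε) : wOmega c (thick S ε).compl) :
        Holo (thick S ε).compl) z = coeff (ω ε : Holo (thick S ε).compl) z - coeff (u ε : Holo ⊤) z := by
    rw [coeff_coe_sub, coeff_wOmegaRestr_of_mem _ _ hz]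
  obtain ⟨ω', hω'⟩ := exists_infToThick_eq
    (ω := fun ε ↦ ω ε - wOmegaRestr c le_top (u ε)) fun ε η h z hz ↦ by
      obtain ⟨v, hv⟩ := exists_entire_sub h1 h le_rfl
      -- The discrepancy `v` between the corrected forms of indices `ε` and `η` is entire and
      -- vanishes off the thickening of index `max η e`, hence everywhere.
      have h3 : (v : Holo ⊤) = 0 := by
        refine Holo.eq_of_eqOn (hS (max η e)) fun w hw ↦ ?_
        have hwη : w ∈ (thick S η).compl := compl_thick_mono (le_max_left η e) hw
        have h4 := hu η w hw
        have h5 := hu ε w (compl_thick_mono (max_le_max h le_rfl) hw)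
        have h6 := hv w hwη
        rw [h2 ε w (compl_thick_mono h hwη), h2 η w hwη] at h6
        change _ = (0 : ℂ)
        linear_combination h5 - h4 - h6
      have h7 := hv z hz
      rw [h3] at h7
      exact sub_eq_zero.1 h7
  refine ⟨ω', Subtype.ext (funext fun ε ↦ ?_)⟩
  rw [limClassLin_apply, hω', h1]

/-- The isomorphism onto the projective limit. -/
def limEquiv (c : ℂ) {S : Closeds ℂ}
    (hS : ∀ ε : Ioi (0 : ℝ), ((thick S ε).compl : Set ℂ).Nonempty) :
    OmegaInfQuot c S ≃ₗ[ℂ] limH1 c S :=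
  quotEquivSubmodule (limClassLin c S) (ker_limClassLin hS) (limClassLin_surjective hS)

lemma limEquiv_mk (hS : ∀ ε : Ioi (0 : ℝ), ((thick S ε).compl : Set ℂ).Nonempty)
    (ω : wOmegaInf c S) (ε : Ioi (0 : ℝ)) :
    (limEquiv c hS (Submodule.Quotient.mk ω)).1 ε =
      dbarClass c (thick S ε) (infToThick c S ε ω) := by
  rw [limEquiv, quotEquivSubmodule_mk, limClassLin_apply]

/-- A closed convex set missing a point lies in a half-plane `f < s`, so its thickening lies in `f ≤
s + ‖f‖ε`. A linear form bounded above on the whole plane is zero, which contradicts the separation.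
-/
lemma nonempty_compl_thick (hconv : Convex ℝ (S : Set ℂ))
    (hline : ∀ a v : ℂ, v ≠ 0 → ∃ t : ℝ, a + t * v ∉ S) (ε : Ioi (0 : ℝ)) :
    ((thick S ε).compl : Set ℂ).Nonempty := by
  obtain ⟨t, ht⟩ := hline 0 1 one_ne_zero
  obtain ⟨f, s, hf, hs⟩ := geometric_hahn_banach_closed_point hconv S.isClosed ht
  by_contra hemp
  have h1 (z : ℂ) : z ∈ Metric.cthickening ε (S : Set ℂ) := by
    by_contra hz
    exact hemp ⟨z, hz⟩
  have h2 (z : ℂ) : f z ≤ s + ‖f‖ * ε := by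
    have hz := h1 z
    rw [Metric.cthickening_eq_biUnion_closedBall _ ε.2.le, S.isClosed.closure_eq] at hz
    simp only [mem_iUnion, exists_prop] at hz
    obtain ⟨x, hx, hzx⟩ := hz
    rw [Metric.mem_closedBall, dist_eq_norm] at hzx
    have h3 := (le_abs_self _).trans (f.le_opNorm (z - x))
    have h4 : ‖f‖ * ‖z - x‖ ≤ ‖f‖ * ε := by gcongr
    have h5 := hf x hx
    rw [map_sub] at h3
    linarith
  have h6 (z : ℂ) : f z = 0 := by
    by_contra hz
    have := h2 (((s + ‖f‖ * ε + 1) / f z) • z)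
    rw [map_smul, smul_eq_mul, div_mul_cancel₀ _ hz] at this
    linarith
  have h7 := h6 (0 + t * 1)
  rw [h7] at hs
  obtain ⟨x, hx⟩ : (S : Set ℂ).Nonempty := by
    rcases (S : Set ℂ).eq_empty_or_nonempty with h | h
    · exact absurd (h1 0) (by rw [h]; simp)
    · exact h
  have := hf x hx
  rw [h6] at this
  linarith

end Limit

end

end TempMeril

namespace TempMeril

noncomputable section

open MeasureTheory Set Filter Topology Complex

/-! ### Representatives given by cutoff functions. -/

section Cutoff

/-- Continuous functions of polynomial growth define tempered distributions. -/
lemma exists_apply_eq_integral {f : ℂ → ℂ} (hf : Continuous f) {C : ℝ} {N : ℕ}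
    (h : ∀ z, ‖f z‖ ≤ C * (1 + ‖z‖) ^ N) :
    ∃ τ : 𝓢'(ℂ, ℂ), ∀ φ : 𝓢(ℂ, ℂ), τ φ = ∫ z, φ z * f z := by
  obtain ⟨n, hn⟩ := (inferInstance : (volume : Measure ℂ).HasTemperateGrowth).exists_integrable
  have hC : 0 ≤ C := by simpa using (norm_nonneg _).trans (h 0)
  -- Of the `n + N` powers of decay of `φ`, `N` absorb the growth of `f` and `n` make the integral
  -- converge.
  set m : ℕ × ℕ := (n + N, 0)
  have h1 (φ : 𝓢(ℂ, ℂ)) (z : ℂ) : ‖φ z * f z‖ ≤ (1 + ‖z‖) ^ (-(n : ℝ)) *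
      (C * (2 ^ (n + N) * ((Finset.Iic m).sup (schwartzSeminormFamily ℂ ℂ ℂ)) φ)) := by
    rw [Real.rpow_neg (by positivity), ← div_eq_inv_mul, le_div_iff₀' (by positivity),
      Real.rpow_natCast]
    have h2 := SchwartzMap.one_add_le_sup_seminorm_apply (𝕜 := ℂ) (m := m) (k := n + N) (n := 0)
      le_rfl le_rfl φ z
    rw [norm_iteratedFDeriv_zero] at h2
    calc (1 + ‖z‖) ^ n * ‖φ z * f z‖ ≤ (1 + ‖z‖) ^ n * (‖φ z‖ * (C * (1 + ‖z‖) ^ N)) := by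
          rw [norm_mul]; gcongr; exact h z
      _ = C * ((1 + ‖z‖) ^ (n + N) * ‖φ z‖) := by ring
      _ ≤ _ := mul_le_mul_of_nonneg_left h2 hC
  have h3 (φ : 𝓢(ℂ, ℂ)) : Integrable fun z ↦ φ z * f z :=
    (hn.mul_const _).mono' (φ.continuous.mul hf).aestronglyMeasurable (.of_forall (h1 φ))
  refine ⟨ContinuousLinearMap.toPointwiseConvergenceCLM _ _ _ _
    (SchwartzMap.mkCLMtoNormedSpace (𝕜 := ℂ) (fun φ : 𝓢(ℂ, ℂ) ↦ ∫ z, φ z * f z) (fun φ ψ ↦ ?_)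
      (fun a φ ↦ ?_) ⟨Finset.Iic m, (∫ z : ℂ, (1 + ‖z‖) ^ (-(n : ℝ))) * (C * 2 ^ (n + N)),
        by positivity, fun φ ↦ ?_⟩), fun φ ↦ rfl⟩
  · rw [← integral_add (h3 φ) (h3 ψ)]
    simp [add_mul]
  · rw [RingHom.id_apply, smul_eq_mul, ← integral_const_mul]
    simp [mul_assoc]
  · refine (norm_integral_le_integral_norm _).trans
      ((integral_mono (h3 φ).norm (hn.mul_const _) (h1 φ)).trans_eq ?_)
    rw [integral_mul_const]
    ring

variable {c : ℂ} {S : Closeds ℂ}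

lemma ball_subset_compl_thick {r : ℝ} (hr : 0 < r) {z : ℂ} (hz : z ∉ thick S (r + r)) :
    Metric.ball z r ⊆ (thick S r).compl := by
  intro w hw hwS
  refine hz (Metric.cthickening_cthickening_subset hr.le hr.le (S : Set ℂ) ?_)
  exact Metric.mem_cthickening_of_dist_le z w r _ hwS (Metric.mem_ball'.1 hw).le

/-- The form is weighted tempered off `S_r`, and discs of radius `r` centred off `S_{2r}` stay off
`S_r`, so the mean value estimate applies at those centres. -/
lemma exists_norm_coeff_le (ω : wOmegaInf c S) {r : ℝ} (hr : 0 < r) :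
    ∃ (C : ℝ) (N : ℕ), ∀ z ∉ thick S (r + r),
      ‖expPair c z * coeff (ω : Holo S.compl) z‖ ≤ C * (1 + ‖z‖) ^ N := by
  set e : Ioi (0 : ℝ) := ⟨r, hr⟩
  obtain ⟨τ, hτ⟩ := (infToThick c S e ω).2
  have hexp : Differentiable ℂ (expPair c) := by unfold expPair; fun_prop
  have hu : DifferentiableOn ℂ (fun z ↦ expPair c z * coeff (ω : Holo S.compl) z)
      (thick S r).compl :=
    hexp.differentiableOn.mul ((differentiableOn_coeff (ω : Holo S.compl)).mono
      (compl_thick_le S r))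
  obtain ⟨C, N, h⟩ := exists_norm_le_of_tempered (τ := τ) hu (fun φ hφ hφU ↦ by
    obtain ⟨ψ, rfl⟩ := exists_toSchwartz_eq hφ hφU
    rw [← hτ, expDist_apply, holoDistr_apply]
    congr 1 with z
    rw [toSchwartz_apply, expTest_apply]
    by_cases hz : z ∈ tsupport ψ
    · rw [coeff_infToThick_of_mem e ω (ψ.tsupport_subset hz)]
      ring
    · rw [image_eq_zero_of_notMem_tsupport hz]
      ring) hr
  exact ⟨C, N, fun z hz ↦ h z (ball_subset_compl_thick hr hz)⟩

lemma continuous_cutoff_mul_coeff (ω : Holo S.compl) {δ : ℝ} (hδ : 0 < δ) {ψ : ℂ → ℝ}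
    (hψ : Continuous ψ) (hψ0 : ∀ z ∈ thick S δ, ψ z = 0) :
    Continuous fun z ↦ (ψ z : ℂ) * coeff ω z := by
  rw [continuous_iff_continuousAt]
  intro z
  by_cases hz : z ∈ S
  · have h : (fun z ↦ (ψ z : ℂ) * coeff ω z) =ᶠ[𝓝 z] fun _ ↦ 0 := by
      filter_upwards [Metric.isOpen_thickening.mem_nhds
        (Metric.self_subset_thickening hδ (S : Set ℂ) hz)] with w hw
      rw [hψ0 w (Metric.thickening_subset_cthickening _ _ hw)]
      simp
    exact continuousAt_const.congr h.symm
  · have h := (differentiableOn_coeff ω).differentiableAt (S.compl.isOpen.mem_nhds hz)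
    exact (Complex.continuous_ofReal.comp hψ).continuousAt.mul h.continuousAt

/-- Cutting off a form which is tempered at infinity gives a weighted tempered form. -/
theorem ofFun_cutoff_mem_wTempered (ω : wOmegaInf c S) {δ : ℝ} (hδ : 0 < δ) {ψ : ℂ → ℝ}
    (hψ : Continuous ψ) (hb : ∃ C : ℝ, ∀ z, |ψ z| ≤ C) (hψ0 : ∀ z ∈ thick S δ, ψ z = 0) :
    ofFun ⊤ (fun z ↦ ψ z * coeff (ω : Holo S.compl) z) ∈ wTempered c ⊤ := by
  have hcont := continuous_cutoff_mul_coeff (ω : Holo S.compl) hδ hψ hψ0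
  obtain ⟨B, hB⟩ := hb
  -- With radius `δ / 2` the bound holds off `S_δ`, which is exactly where `ψ` may be nonzero.
  obtain ⟨C, N, h⟩ := exists_norm_coeff_le ω (half_pos hδ)
  rw [add_halves] at h
  have hB0 : 0 ≤ B := (abs_nonneg _).trans (hB 0)
  obtain ⟨τ, hτ⟩ := exists_apply_eq_integral
    (f := fun z ↦ expPair c z * (ψ z * coeff (ω : Holo S.compl) z))
    ((contDiff_expPair c (n := 0)).continuous.mul hcont) (C := B * |C|) (N := N) fun z ↦ by
      by_cases hz : z ∈ thick S δ
      · rw [hψ0 z hz]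
        simp only [ofReal_zero, zero_mul, mul_zero, norm_zero]
        positivity
      · calc ‖expPair c z * (ψ z * coeff (ω : Holo S.compl) z)‖
            = |ψ z| * ‖expPair c z * coeff (ω : Holo S.compl) z‖ := by
              rw [mul_left_comm, norm_mul, norm_real, Real.norm_eq_abs]
          _ ≤ B * (|C| * (1 + ‖z‖) ^ N) := by
              gcongr
              · exact hB z
              · exact (h z hz).trans (by gcongr; exact le_abs_self C)
          _ = _ := by ring
  refine ⟨τ, fun φ ↦ ?_⟩
  rw [hτ, expDist_apply]
  refine (TestFunction.integralAgainstBilinCLM_eq_integral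
    (hcont.locallyIntegrable.locallyIntegrableOn _)).trans ?_
  congr 1 with z
  simp only [ContinuousLinearMap.mul_apply', expTest_apply, toSchwartz_apply]
  ring

lemma restr_ofFun_cutoff (ω : wOmegaInf c S) {ε : Ioi (0 : ℝ)} {ψ : ℂ → ℝ}
    (hcont : Continuous fun z ↦ (ψ z : ℂ) * coeff (ω : Holo S.compl) z)
    (hψ1 : ∀ z ∉ thick S ε, ψ z = 1) :
    restr (thick S ε).compl (ofFun ⊤ (fun z ↦ ψ z * coeff (ω : Holo S.compl) z)) =
      holoDistr (thick S ε).compl (infToThick c S ε ω) := by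
  ext φ
  rw [restr_apply, holoDistr_apply]
  refine (TestFunction.integralAgainstBilinCLM_eq_integral
    (hcont.locallyIntegrable.locallyIntegrableOn _)).trans ?_
  congr 1 with z
  by_cases hz : z ∈ tsupport φ
  · have hz' := φ.tsupport_subset hz
    rw [coeff_infToThick_of_mem ε ω hz', hψ1 z hz']
    simp
  · have h3 : φ z = 0 := image_eq_zero_of_notMem_tsupport hz
    simp [h3]

end Cutoff

end

end TempMeril

open TempMeril in
theorem proposition8p1 (S : TopologicalSpace.Closeds ℂ) (hne : (S : Set ℂ).Nonempty)
    (hconv : Convex ℝ (S : Set ℂ)) (hnc : ¬ IsCompact (S : Set ℂ))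
    (hline : ∀ a v : ℂ, v ≠ 0 → ∃ t : ℝ, a + t * v ∉ S)
    (ξ₀ : ℂ) (ε' : ℝ) (hε' : 0 < ε') :
    -- the isomorphisms `[ω] ↦ [∂̄ T]`, with `T` any tempered distributional extension of `ω`
    ∃ Φ : ∀ ε : Set.Ioi (0 : ℝ),
        OmegaQuot (ε' * ξ₀) (thick S ε) ≃ₗ[ℂ] H1 (ε' * ξ₀) (thick S ε),
      (∀ (ε : Set.Ioi (0 : ℝ)) (ω : wOmega (ε' * ξ₀) (thick S ε).compl),
        (∃ T ∈ wTempered (ε' * ξ₀) ⊤,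
          restr (thick S ε).compl T = holoDistr (thick S ε).compl ω) ∧
        ∀ T ∈ wTempered (ε' * ξ₀) ⊤,
          restr (thick S ε).compl T = holoDistr (thick S ε).compl ω →
          ∃ R : secSupp (ε' * ξ₀) (thick S ε), (R : Distr ⊤) = dbar ⊤ T ∧
            Φ ε (Submodule.Quotient.mk ω) = Submodule.Quotient.mk R) ∧
      -- the isomorphism onto the projective limit
      ∃ Ψ : OmegaInfQuot (ε' * ξ₀) S ≃ₗ[ℂ] limH1 (ε' * ξ₀) S,
        (∀ (ω : wOmegaInf (ε' * ξ₀) S) (ε : Set.Ioi (0 : ℝ)),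
          (Ψ (Submodule.Quotient.mk ω)).1 ε =
            Φ ε (Submodule.Quotient.mk (infToThick (ε' * ξ₀) S ε ω))) ∧
        -- its components in terms of cutoff functions
        ∀ (ω : wOmegaInf (ε' * ξ₀) S) (ε : Set.Ioi (0 : ℝ)) (ψ : ℂ → ℝ),
          ContDiff ℝ (⊤ : ℕ∞) ψ → (∃ C : ℝ, ∀ z, |ψ z| ≤ C) →
          (∀ z ∉ thick S ε, ψ z = 1) → (∀ z ∈ thick S (ε / 2), ψ z = 0) →
          ∃ R : secSupp (ε' * ξ₀) (thick S ε),
            (R : Distr ⊤) = dbar ⊤ (ofFun ⊤ fun z ↦ ψ z * coeff (ω : Holo S.compl) z) ∧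
            (Ψ (Submodule.Quotient.mk ω)).1 ε = Submodule.Quotient.mk R := by
  have hS := nonempty_compl_thick hconv hline
  refine ⟨fun ε ↦ dbarEquiv _ _, fun ε ω ↦ ⟨exists_extension ω, fun T hT h ↦ ?_⟩,
    limEquiv _ hS, fun ω ε ↦ ?_, fun ω ε ψ hψ hb hψ1 hψ0 ↦ ?_⟩
  · obtain ⟨R, hR, e⟩ := exists_dbarClass_eq hT h
    exact ⟨R, hR, (dbarEquiv_mk ω).trans e⟩
  · rw [limEquiv_mk, dbarEquiv_mk]
  -- The cut-off form is a weighted tempered extension of `ω` off `S_ε`, so independence of the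
  -- extension identifies its class.
  · have hε : 0 < (ε : ℝ) / 2 := half_pos ε.2
    obtain ⟨R, hR, e⟩ := exists_dbarClass_eq
      (ofFun_cutoff_mem_wTempered ω hε hψ.continuous hb hψ0)
      (restr_ofFun_cutoff ω (continuous_cutoff_mul_coeff _ hε hψ.continuous hψ0) hψ1)
    exact ⟨R, hR, (limEquiv_mk hS ω ε).trans e⟩
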